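/- A simple stochastic game (SSG) $G$ is a finite directed graph whose vertices are partitioned into MAX vertices, MIN vertices, random vertices and sinks (at least one), such that every vertex that is not a sink has an outgoing arc, every sink has exactly one outgoing arc, a loop on itself, every random vertex $x$ carries a probability distribution $p_x$ whose support is the set $N^+(x)$ of outneighbours of $x$, and every sink $s$ has a value $\mathrm{Val}(s)\in[0,1]$. The game is not assumed to be stopping. Strategies are positional; $v_{\sigma,\tau}(x)$ is the expected value of the play from $x$ under $(\sigma,\tau)$, where a play is worth the value of the sink it reaches and $0$ if it reaches no sink; $v_\sigma=\min_\tau v_{\sigma,\tau}$ for a MAX strategy $\sigma$ and $v_\tau=\max_\sigma v_{\sigma,\tau}$ for a MIN strategy $\tau$; $v^*=\max_\sigma v_\sigma$ (all pointwise) is the optimal value vector. A MAX strategy $\sigma$ is optimal if there is a MIN strategy $\tau$ with $v_{\sigma,\tau}=v_\sigma=v_\tau=v^*$. We write $\sigma'\succ\sigma$ if $v_{\sigma'}\ge v_\sigma$, $v_{\sigma'}\neq v_\sigma$, and $\sigma'(x)=\sigma(x)$ for every MAX vertex $x$ with $v_{\sigma'}(x)=v_\sigma(x)$. For a set $A$ of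 arcs and $f:A\to[0,1]$, $G[A,f]$ is the game obtained by redirecting each arc $e\in A$ to a new sink of value $f(e)$; $G[A,\sigma]$ is the case $f((x,y))=v_\sigma(y)$. Strategies of $G$ and of $G[A,f]$ are identified. Let $R$ be the set of arcs going out of random vertices. Opt-GSIA with fixed arc set $A$ starts from any MAX strategy $\sigma_0$ and, while $\sigma_i$ is not optimal in $G$, chooses any $\sigma_{i+1}$ that is optimal in $G[A,\sigma_i]$ and satisfies $\sigma_{i+1}\succ\sigma_i$ in $G[A,\sigma_i]$. (When $\sigma_i$ is optimal the algorithm stops, and we put $\sigma_{i+1}=\sigma_i$.) The Ibsen-Jensen–Miltersen algorithm (IJMA) keeps a vector $v^{\mathrm{IJMA}}_i$ on the random vertices. It starts from $v^{\mathrm{IJMA}}_0=0$, and its iteration number $i+1$ computes the optimal values $v'^{\,\mathrm{IJMA}}_i$, on the vertices of $G$, of the deterministic game $G[R,v^{\mathrm{IJMA}}_i]$, in which every random vertex $x$ amounts to a sink of value $v^{\mathrm{IJMA}}_i(x)$, and then puts $v^{\mathrm{IJMA}}_{i+1}(x)=\sum_{y\in N^+(x)}p_x(y)\,v'^{\,\mathrm{IJMA}}_i(y)$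 for every random vertex $x$. **Theorem.** Let $G$ be an SSG and let $A\subseteq R$. Opt-GSIA with fixed arc set $A$ can be run from every initial strategy, and every run $\sigma_0,\sigma_1,\dots$ of it satisfies: 1. $v_{\sigma_i}(x)\ge v^{\mathrm{IJMA}}_i(x)$ for every $i\ge 0$ and every random vertex $x$, and $v_{\sigma_{i+1}}(x)\ge v'^{\,\mathrm{IJMA}}_i(x)$ for every $i\ge0$ and every vertex $x$. 2. The run reaches an optimal strategy. Let $n$ be the number of its iterations, i.e. the least index such that $\sigma_n$ is optimal. If IJMA finds the optimal values of $G$ at its iteration $N$, then $n\le N$. This holds in both of the following senses of "finds": (a) exactly: $N=i+1$ and $v'^{\,\mathrm{IJMA}}_i=v^*$; (b) by rounding: $G$ is a $q$-SSG with $r$ random vertices, i.e. it has exactly two sinks, of values $0$ and $1$, and for every random vertex $x$ there is a positive integer $q_x\le q$ such that all $q_x\,p_x(y)$ are integers; $D\ge q^r$ is an integer; $N=i+1$; and the optimal values of the deterministic game $G[R,w]$ equal $v^*$ on all vertices of $G$, where $w\in[0,1]^{V_R}$ rounds each $v^{\mathrm{IJMA}}_i(x)$ to a nearest fraction with denominator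 at most $D$. -/

import Mathlib

open MeasureTheory ProbabilityTheory

noncomputable section

/-- The four kinds of vertices of a simple stochastic game. -/
inductive VertexKind where
  | max
  | min
  | random
  | sink

/-- A simple stochastic game with vertex set `V`. The fields `prob` and `val` are only meaningful
at random vertices and at sinks respectively; their other values are never used. -/
structure SSG (V : Type*) where
  kind : V → VertexKind
  /-- `Adj x y`: there is an arc from `x` to `y`. -/
  Adj : V → V → Prop
  exists_adj : ∀ x, kind x ≠ .sink → ∃ y, Adj x y
  sink_adj : ∀ s, kind s = .sink → ∀ y, Adj s y ↔ y = s
  exists_sink : ∃ s, kind s = .sink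
  prob : V → PMF V
  prob_ne_zero_iff : ∀ x, kind x = .random → ∀ y, prob x y ≠ 0 ↔ Adj x y
  val : V → ℝ
  val_mem : ∀ s, kind s = .sink → val s ∈ Set.Icc (0 : ℝ) 1

namespace SSG

/-! ### Strategies, plays and values -/

/-- Positional strategies of player MAX. -/
abbrev MaxStrategy {V : Type*} (G : SSG V) : Type _ :=
  (x : {x : V // G.kind x = .max}) → {y : V // G.Adj x.1 y}

/-- Positional strategies of player MIN. -/
abbrev MinStrategy {V : Type*} (G : SSG V) : Type _ :=
  (x : {x : V // G.kind x = .min}) → {y : V // G.Adj x.1 y}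

/-- The random vertices. -/
abbrev RandomVertex {V : Type*} (G : SSG V) : Type _ := {x : V // G.kind x = .random}

instance {V : Type*} (G : SSG V) : Nonempty G.MaxStrategy :=
  ⟨fun x => ⟨_, (G.exists_adj x.1 (by rw [x.2]; exact VertexKind.noConfusion)).choose_spec⟩⟩

instance {V : Type*} (G : SSG V) : Nonempty G.MinStrategy :=
  ⟨fun x => ⟨_, (G.exists_adj x.1 (by rw [x.2]; exact VertexKind.noConfusion)).choose_spec⟩⟩

/-- The distribution of the vertex that follows `x` when the players use `σ` and `τ`. -/
def next {V : Type*} (G : SSG V) (σ : G.MaxStrategy) (τ : G.MinStrategy) (x : V) : PMF V :=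
  match h : G.kind x with
  | .max => PMF.pure (σ ⟨x, h⟩).1
  | .min => PMF.pure (τ ⟨x, h⟩).1
  | .random => G.prob x
  | .sink => PMF.pure x

/-- The law of the next vertex of a play given its first `n + 1` vertices. -/
def nextKernel {V : Type*} [Finite V] (G : SSG V) (σ : G.MaxStrategy) (τ : G.MinStrategy) (n : ℕ) :
    letI : MeasurableSpace V := ⊤
    Kernel (Finset.Iic n → V) V :=
  letI : MeasurableSpace V := ⊤
  Kernel.ofFunOfCountable fun h => (G.next σ τ (h ⟨n, Finset.mem_Iic.2 le_rfl⟩)).toMeasure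

instance {V : Type*} [Finite V] (G : SSG V) (σ : G.MaxStrategy) (τ : G.MinStrategy) (n : ℕ) :
    letI : MeasurableSpace V := ⊤
    IsMarkovKernel (G.nextKernel σ τ n) :=
  letI : MeasurableSpace V := ⊤
  ⟨fun h => by
    change IsProbabilityMeasure (G.next σ τ (h ⟨n, Finset.mem_Iic.2 le_rfl⟩)).toMeasure
    infer_instance⟩

/-- The distribution on plays that start in `x₀` when the players use `σ` and `τ`. -/
def playMeasure {V : Type*} [Finite V] (G : SSG V) (σ : G.MaxStrategy) (τ : G.MinStrategy)
    (x₀ : V) :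
    letI : MeasurableSpace V := ⊤
    Measure (ℕ → V) :=
  letI : MeasurableSpace V := ⊤
  Kernel.traj (X := fun _ => V) (G.nextKernel σ τ) 0 fun _ => x₀

open Classical in
/-- The value of a play: the value of the sink that it reaches, and `0` if it reaches no sink. -/
def playVal {V : Type*} (G : SSG V) (X : ℕ → V) : ℝ :=
  if h : ∃ t, G.kind (X t) = .sink then G.val (X (Nat.find h)) else 0

/-- The value vector of a pair of strategies: the expected value of the play. -/
def pairVal {V : Type*} [Finite V] (G : SSG V) (σ : G.MaxStrategy) (τ : G.MinStrategy)
    (x : V) : ℝ :=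
  letI : MeasurableSpace V := ⊤
  ∫ X, G.playVal X ∂(G.playMeasure σ τ x)

/-- The value vector of a MAX strategy, i.e. its value against a best response of MIN. -/
def maxVal {V : Type*} [Finite V] (G : SSG V) (σ : G.MaxStrategy) (x : V) : ℝ :=
  ⨅ τ : G.MinStrategy, G.pairVal σ τ x

/-- The value vector of a MIN strategy, i.e. its value against a best response of MAX. -/
def minVal {V : Type*} [Finite V] (G : SSG V) (τ : G.MinStrategy) (x : V) : ℝ :=
  ⨆ σ : G.MaxStrategy, G.pairVal σ τ x

/-- The optimal value vector of the game. -/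
def optVal {V : Type*} [Finite V] (G : SSG V) (x : V) : ℝ :=
  ⨆ σ : G.MaxStrategy, G.maxVal σ x

/-- A MAX strategy is optimal if it belongs to a pair of optimal strategies. -/
def IsOptimal {V : Type*} [Finite V] (G : SSG V) (σ : G.MaxStrategy) : Prop :=
  ∃ τ : G.MinStrategy,
    G.pairVal σ τ = G.optVal ∧ G.maxVal σ = G.optVal ∧ G.minVal τ = G.optVal

/-- `σ' ≻ σ`: the value vector strictly increases, and `σ'` agrees with `σ` at every MAX vertex
whose value does not change. -/
def StrictlyImproves {V : Type*} [Finite V] (G : SSG V) (σ' σ : G.MaxStrategy) : Prop :=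
  G.maxVal σ < G.maxVal σ' ∧ ∀ x, G.maxVal σ' x.1 = G.maxVal σ x.1 → σ' x = σ x

lemma playVal_mem {V : Type*} (G : SSG V) (X : ℕ → V) : G.playVal X ∈ Set.Icc (0 : ℝ) 1 := by
  classical
  unfold playVal
  split_ifs with h
  · exact G.val_mem _ (Nat.find_spec h)
  · simp

lemma pairVal_mem {V : Type*} [Finite V] (G : SSG V) (σ : G.MaxStrategy) (τ : G.MinStrategy)
    (x : V) : G.pairVal σ τ x ∈ Set.Icc (0 : ℝ) 1 := by
  let : MeasurableSpace V := ⊤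
  have : IsProbabilityMeasure (G.playMeasure σ τ x) := by
    unfold playMeasure
    infer_instance
  refine ⟨integral_nonneg fun X => (G.playVal_mem X).1, ?_⟩
  have h := integral_mono_of_nonneg (μ := G.playMeasure σ τ x) (f := G.playVal) (g := fun _ => 1)
    (Filter.Eventually.of_forall fun X => (G.playVal_mem X).1) (integrable_const _)
    (Filter.Eventually.of_forall fun X => (G.playVal_mem X).2)
  rw [integral_const, probReal_univ, one_smul] at h
  exact h

lemma maxVal_mem {V : Type*} [Finite V] (G : SSG V) (σ : G.MaxStrategy) (x : V) :
    G.maxVal σ x ∈ Set.Icc (0 : ℝ) 1 :=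
  ⟨le_ciInf fun τ => (G.pairVal_mem σ τ x).1,
    (ciInf_le ⟨0, by rintro _ ⟨τ, rfl⟩; exact (G.pairVal_mem σ τ x).1⟩
      (Classical.arbitrary G.MinStrategy)).trans (G.pairVal_mem σ _ x).2⟩

lemma optVal_mem {V : Type*} [Finite V] (G : SSG V) (x : V) :
    G.optVal x ∈ Set.Icc (0 : ℝ) 1 :=
  ⟨(G.maxVal_mem (Classical.arbitrary G.MaxStrategy) x).1.trans
    (le_ciSup (f := fun σ => G.maxVal σ x)
      ⟨1, by rintro _ ⟨σ, rfl⟩; exact (G.maxVal_mem σ x).2⟩ _),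
    ciSup_le fun σ => (G.maxVal_mem σ x).2⟩

/-! ### The transformed game -/

/-- The arcs of the game, without the loops on the sinks. -/
abbrev Arc {V : Type*} (G : SSG V) : Type _ :=
  {e : V × V // G.Adj e.1 e.2 ∧ G.kind e.1 ≠ .sink}

open Classical in
/-- The end vertex of the arc from `x` to `y` once the arcs of `A` are redirected to new sinks:
the new sink of the arc if it lies in `A`, and `y` otherwise. -/
def redirect {V : Type*} (G : SSG V) (A : Set G.Arc) (x y : V) : V ⊕ A :=
  if h : ∃ e : A, e.1.1 = (x, y) then .inr h.choose else .inl y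

lemma redirect_of_sink {V : Type*} (G : SSG V) (A : Set G.Arc) (x y : V)
    (hx : G.kind x = .sink) : G.redirect A x y = .inl y := by
  unfold redirect
  rw [dif_neg]
  rintro ⟨e, he⟩
  exact e.1.2.2 (by rw [he]; exact hx)

/-- The game `G[A, f]`: every arc `e` of `A` is redirected to a new sink of value `f e`. -/
def transform {V : Type*} (G : SSG V) (A : Set G.Arc) (f : A → Set.Icc (0 : ℝ) 1) :
    SSG (V ⊕ A) where
  kind := Sum.elim G.kind fun _ => .sink
  Adj z z' := match z with
    | .inl x => ∃ y, G.Adj x y ∧ z' = G.redirect A x y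
    | .inr e => z' = .inr e
  exists_adj := by
    rintro (x | e) h
    · obtain ⟨y, hy⟩ := G.exists_adj x h
      exact ⟨_, y, hy, rfl⟩
    · exact ⟨_, rfl⟩
  sink_adj := by
    rintro (x | e) h z
    · have hx : G.kind x = .sink := h
      constructor
      · rintro ⟨y, hy, rfl⟩
        rw [(G.sink_adj x hx y).1 hy, G.redirect_of_sink A x x hx]
      · rintro rfl
        exact ⟨x, (G.sink_adj x hx x).2 rfl, (G.redirect_of_sink A x x hx).symm⟩
    · exact Iff.rfl
  exists_sink := G.exists_sink.imp' Sum.inl fun _ h => h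
  prob := Sum.elim (fun x => (G.prob x).map (G.redirect A x)) fun e => PMF.pure (.inr e)
  prob_ne_zero_iff := by
    rintro (x | e) h z
    · have hx : G.kind x = .random := h
      change (G.prob x).map (G.redirect A x) z ≠ 0 ↔ _
      rw [← PMF.mem_support_iff, PMF.mem_support_map_iff]
      constructor
      · rintro ⟨y, hy, rfl⟩
        exact ⟨y, (G.prob_ne_zero_iff x hx y).1 hy, rfl⟩
      · rintro ⟨y, hy, rfl⟩
        exact ⟨y, (G.prob_ne_zero_iff x hx y).2 hy, rfl⟩
    · exact absurd h VertexKind.noConfusion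
  val := Sum.elim G.val fun e => f e
  val_mem := by
    rintro (x | e) h
    · exact G.val_mem x h
    · exact (f e).2

/-- A MAX strategy of `G`, seen as a strategy of `G[A, f]`. -/
def liftStrategy {V : Type*} (G : SSG V) (A : Set G.Arc) (f : A → Set.Icc (0 : ℝ) 1)
    (σ : G.MaxStrategy) : (G.transform A f).MaxStrategy
  | ⟨.inl x, h⟩ => ⟨G.redirect A x (σ ⟨x, h⟩).1, (σ ⟨x, h⟩).1, (σ ⟨x, h⟩).2, rfl⟩
  | ⟨.inr _, h⟩ => absurd h VertexKind.noConfusion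

/-- The sink values of `G[A, σ]`: the arc from `x` to `y` gets the value of `σ` at `y`. -/
def arcVal {V : Type*} [Finite V] (G : SSG V) (A : Set G.Arc) (σ : G.MaxStrategy) (e : A) :
    Set.Icc (0 : ℝ) 1 :=
  ⟨G.maxVal σ e.1.1.2, G.maxVal_mem σ e.1.1.2⟩

/-! ### The two algorithms -/

/-- One iteration of Opt-GSIA with fixed arcs `A`: in `G[A, σ]`, the new strategy `σ'` is optimal
and satisfies `σ' ≻ σ`. -/
def OptGSIAStep {V : Type*} [Finite V] (G : SSG V) (A : Set G.Arc) (σ σ' : G.MaxStrategy) : Prop :=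
  (G.transform A (G.arcVal A σ)).IsOptimal (G.liftStrategy A (G.arcVal A σ) σ') ∧
  (G.transform A (G.arcVal A σ)).StrictlyImproves
    (G.liftStrategy A (G.arcVal A σ) σ') (G.liftStrategy A (G.arcVal A σ) σ)

/-- `σ i` is the strategy held after `i` iterations of a run of Opt-GSIA with fixed arcs `A`. Once
an optimal strategy is held the run has stopped, and the sequence stays constant. -/
def IsOptGSIARun {V : Type*} [Finite V] (G : SSG V) (A : Set G.Arc) (σ : ℕ → G.MaxStrategy) :
    Prop :=
  ∀ i, (¬ G.IsOptimal (σ i) → G.OptGSIAStep A (σ i) (σ (i + 1))) ∧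
    (G.IsOptimal (σ i) → σ (i + 1) = σ i)

/-- The set `R` of the arcs out of random vertices. -/
def randomArcs {V : Type*} (G : SSG V) : Set G.Arc := {e | G.kind e.1.1 = .random}

/-- The optimal values, on the vertices of `G`, of the deterministic game `G[R, w]`, for a vector
`w` on the random vertices: all arcs out of a random vertex `x` are redirected to sinks of value
`w x`, so that `x` itself amounts to a sink of value `w x`. -/
def detVal {V : Type*} [Finite V] (G : SSG V) (w : G.RandomVertex → Set.Icc (0 : ℝ) 1)
    (x : V) : ℝ :=
  (G.transform G.randomArcs fun e => w ⟨e.1.1.1, e.2⟩).optVal (.inl x)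

lemma sum_prob_mul_mem {V : Type*} [Fintype V] (G : SSG V) (x : V) (u : V → ℝ)
    (hu : ∀ y, u y ∈ Set.Icc (0 : ℝ) 1) :
    ∑ y, (G.prob x y).toReal * u y ∈ Set.Icc (0 : ℝ) 1 := by
  refine ⟨Finset.sum_nonneg fun y _ => mul_nonneg ENNReal.toReal_nonneg (hu y).1, ?_⟩
  calc ∑ y, (G.prob x y).toReal * u y ≤ ∑ y, (G.prob x y).toReal :=
        Finset.sum_le_sum fun y _ => mul_le_of_le_one_right ENNReal.toReal_nonneg (hu y).2
    _ = (∑ y, G.prob x y).toReal :=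
        (ENNReal.toReal_sum fun y _ => (G.prob x).apply_ne_top y).symm
    _ = 1 := by rw [← tsum_fintype (L := .unconditional V), (G.prob x).tsum_coe, ENNReal.toReal_one]
    _ ≤ 1 := le_rfl

/-- The value vector held by the Ibsen-Jensen–Miltersen algorithm after `i` iterations. -/
def ijma {V : Type*} [Fintype V] (G : SSG V) : ℕ → G.RandomVertex → Set.Icc (0 : ℝ) 1
  | 0 => fun _ => ⟨0, by simp⟩
  | i + 1 => fun x =>
      ⟨∑ y, (G.prob x.1 y).toReal * G.detVal (G.ijma i) y,
        G.sum_prob_mul_mem x.1 _ fun _ => optVal_mem _ _⟩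

/-! ### Rounding -/

/-- A `q`-SSG: exactly two sinks, of values `0` and `1`, and probabilities at every random vertex
with a common denominator at most `q`. -/
def IsQSSG {V : Type*} (G : SSG V) (q : ℕ) : Prop :=
  (∃ s₀ s₁, G.kind s₀ = .sink ∧ G.val s₀ = 0 ∧ G.kind s₁ = .sink ∧ G.val s₁ = 1 ∧
    ∀ s, G.kind s = .sink → s = s₀ ∨ s = s₁) ∧
  ∀ x, G.kind x = .random → ∃ qx : ℕ, 0 < qx ∧ qx ≤ q ∧
    ∀ y, ∃ l : ℕ, (G.prob x y).toReal = l / qx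

end SSG

/-- `a` is a fraction with positive denominator at most `D`. -/
def IsFractionLE (D : ℕ) (a : ℝ) : Prop :=
  ∃ (k : ℤ) (m : ℕ), 0 < m ∧ m ≤ D ∧ a = k / m

/-- `b` is a fraction with denominator at most `D` that is nearest to `a`. -/
def IsNearestFraction (D : ℕ) (a b : ℝ) : Prop :=
  IsFractionLE D b ∧ ∀ c, IsFractionLE D c → |a - b| ≤ |a - c|

end

/-! Upper bounds on values are easy: the value of a strategy pair is the least nonnegative vector
that is superharmonic and dominates the sink values, and `maxVal_le_of_kinds` and
`optVal_le_of_kinds` extend this to one-sided and optimal values. Lower bounds are delicate because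
the game need not stop. By the maximum principle, a subharmonic vector that fails to be a lower
bound is constant and positive on a set without sinks in which the play stays
(`exists_closed_of_not_le_pairVal`, `exists_closed_of_not_le_maxVal`). Such a trap is worth `0`. The
clause of `≻` that forbids changing a choice where the value is unchanged is what rules traps out.

The heart is `OptGSIAStep.optVal_le`: after a step from `σ` to `σ'`, the value of `σ'` in `G` is at
least the optimal value of `G[A, σ]`. If a vector `w` on the random vertices lies below `v_σ`, then
the optimal values of `G[A, σ]` dominate those of `G[R, w]`, since they solve the same equations off
the random vertices and are at least `v_σ` on them. Averaging at random vertices and induction on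
`i` give the comparison with IJMA. Values increase strictly until an optimal strategy is held and
there are finitely many strategies, so the run stops; it has stopped as soon as some dominated `w`
yields the optimal values.

For rounding, Cramer's rule and a determinant bound show that values at random vertices of a `q`-SSG
are fractions with denominator at most `q ^ r`. A number below such a fraction cannot be rounded
beyond it, so the rounded vector is still dominated. -/

noncomputable section

/-! ### Averages over finitely supported distributions -/

namespace PMF

/-- The expected value of `u` under `p`. -/
def avg {V : Type*} (p : PMF V) (u : V → ℝ) : ℝ := ∑' y, (p y).toReal * u y

section avg

variable {V : Type*} (p : PMF V) (u w : V → ℝ)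

lemma avg_eq_sum [Fintype V] : p.avg u = ∑ y, (p y).toReal * u y := tsum_fintype _

lemma avg_eq_integral [Finite V] [MeasurableSpace V] [DiscreteMeasurableSpace V] :
    p.avg u = ∫ y, u y ∂p.toMeasure := by
  cases nonempty_fintype V
  rw [avg_eq_sum, PMF.integral_eq_sum]
  rfl

lemma avg_eq_sum_subtype [Fintype V] {P : V → Prop} [Fintype {x // P x}] 
    (hu : ∀ x, ¬ P x → u x = 0) : p.avg u = ∑ y : {x // P x}, (p y.1).toReal * u y.1 := by
  classical
  rw [avg_eq_sum, ← Finset.sum_subtype (Finset.univ.filter P) (by simp)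
    fun y => (p y).toReal * u y]
  refine (Finset.sum_filter_of_ne fun x _ hx => ?_).symm
  by_contra h
  exact hx (by rw [hu x h, mul_zero])

lemma sum_toReal [Fintype V] : ∑ y, (p y).toReal = 1 := by
  rw [← ENNReal.toReal_sum fun y _ => p.apply_ne_top y,
    ← tsum_fintype (L := .unconditional V), p.tsum_coe, ENNReal.toReal_one]

variable {u w}

lemma avg_mono [Finite V] (h : ∀ y, p y ≠ 0 → u y ≤ w y) : p.avg u ≤ p.avg w := by
  cases nonempty_fintype V
  rw [avg_eq_sum, avg_eq_sum]
  refine Finset.sum_le_sum fun y _ => ?_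
  by_cases hy : p y = 0
  · simp [hy]
  · exact mul_le_mul_of_nonneg_left (h y hy) ENNReal.toReal_nonneg

lemma avg_congr (h : ∀ y, p y ≠ 0 → u y = w y) : p.avg u = p.avg w := by
  refine tsum_congr fun y => ?_
  by_cases hy : p y = 0
  · simp [hy]
  · rw [h y hy]

lemma avg_const [Finite V] (c : ℝ) : p.avg (fun _ => c) = c := by
  cases nonempty_fintype V
  rw [avg_eq_sum, ← Finset.sum_mul, sum_toReal, one_mul]

lemma avg_sub [Finite V] (u w : V → ℝ) : p.avg (fun y => u y - w y) = p.avg u - p.avg w := by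
  cases nonempty_fintype V
  simp only [avg_eq_sum, mul_sub, Finset.sum_sub_distrib]

lemma avg_mul_left [Finite V] (c : ℝ) (u : V → ℝ) : p.avg (fun y => c * u y) = c * p.avg u := by
  cases nonempty_fintype V
  simp only [avg_eq_sum, Finset.mul_sum]
  exact Finset.sum_congr rfl fun y _ => by ring

@[simp]
lemma avg_pure [Finite V] (x : V) (u : V → ℝ) : (PMF.pure x).avg u = u x := by
  rw [avg_congr (w := fun _ => u x), avg_const]
  intro y hy
  rw [← PMF.mem_support_iff, PMF.mem_support_pure_iff] at hy
  rw [hy]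

lemma avg_map [Finite V] {W : Type*} [Finite W] (f : V → W) (u : W → ℝ) :
    (p.map f).avg u = p.avg fun y => u (f y) := by
  let : MeasurableSpace V := ⊤
  let : MeasurableSpace W := ⊤
  rw [avg_eq_integral, avg_eq_integral, ← PMF.toMeasure_map (f := f) p (measurable_of_finite f),
    integral_map (measurable_of_finite f).aemeasurable
      (measurable_of_finite u).aestronglyMeasurable]

/-- The maximum principle in one step: the nonnegative terms `p z * (M - u z)` have sum at most `0`,
so each vanishes. -/
lemma eq_of_le_avg [Finite V] {M : ℝ} (h : ∀ y, p y ≠ 0 → u y ≤ M) (hM : M ≤ p.avg u) {y : V}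
    (hy : p y ≠ 0) : u y = M := by
  cases nonempty_fintype V
  have h0 : ∀ z ∈ Finset.univ, 0 ≤ (p z).toReal * (M - u z) := fun z _ => by
    by_cases hz : p z = 0
    · simp [hz]
    · exact mul_nonneg ENNReal.toReal_nonneg (sub_nonneg.2 (h z hz))
  have h1 : ∑ z, (p z).toReal * (M - u z) = 0 := by
    refine le_antisymm ?_ (Finset.sum_nonneg h0)
    have := p.avg_sub (fun _ => M) u
    rw [avg_const, avg_eq_sum] at this
    linarith
  have h2 := (Finset.sum_eq_zero_iff_of_nonneg h0).1 h1 y (Finset.mem_univ y)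
  rcases mul_eq_zero.1 h2 with h3 | h3
  · rcases (ENNReal.toReal_eq_zero_iff _).1 h3 with h4 | h4
    · exact absurd h4 hy
    · exact absurd h4 (p.apply_ne_top y)
  · linarith

lemma tendsto_avg [Finite V] {a : ℕ → V → ℝ} {b : V → ℝ}
    (h : ∀ y, Filter.Tendsto (fun n => a n y) Filter.atTop (nhds (b y))) :
    Filter.Tendsto (fun n => p.avg (a n)) Filter.atTop (nhds (p.avg b)) := by
  cases nonempty_fintype V
  simp only [avg_eq_sum]
  exact tendsto_finsetSum _ fun y _ => (h y).const_mul _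

end avg

end PMF

/-! ### Finite Markov chains -/

/-- The expected value of `g` after `n` steps of the chain. -/
def iterAvg {V : Type*} (P : V → PMF V) (g : V → ℝ) : ℕ → V → ℝ
  | 0 => g
  | n + 1 => fun x => (P x).avg (iterAvg P g n)

/-- The definition conditions on the first step of the chain; the law of a trajectory is unfolded at
the last step, which needs this form. -/
lemma iterAvg_succ' {V : Type*} (P : V → PMF V) (g : V → ℝ) (n : ℕ) :
    iterAvg P g (n + 1) = iterAvg P (fun x => (P x).avg g) n := by
  induction n with
  | zero => rfl
  | succ n ih => funext x; exact congrArg _ ih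

section MarkovChain

variable {V : Type*} [Finite V] [MeasurableSpace V] [DiscreteMeasurableSpace V]

/-- The Markov property: the joint law of the first `n + 1` vertices and the next one is a
composition product, so the last coordinate can be integrated out first. -/
lemma integral_traj_step (P : V → PMF V) (κ : ∀ n : ℕ, Kernel (Finset.Iic n → V) V)
    [∀ n, IsMarkovKernel (κ n)]
    (hκ : ∀ n h, κ n h = (P (h ⟨n, Finset.mem_Iic.2 le_rfl⟩)).toMeasure)
    (a : Finset.Iic 0 → V) (n : ℕ) (f : V → V → ℝ) :
    ∫ X, f (X n) (X (n + 1)) ∂(Kernel.traj (X := fun _ => V) κ 0 a) =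
      ∫ X, (P (X n)).avg (f (X n)) ∂(Kernel.traj (X := fun _ => V) κ 0 a) := by
  have hn : n ∈ Finset.Iic n := Finset.mem_Iic.2 le_rfl
  have h1 : ∫ X, f (X n) (X (n + 1)) ∂(Kernel.traj (X := fun _ => V) κ 0 a) =
      ∫ z, f (z.1 ⟨n, hn⟩) z.2 ∂((Kernel.traj (X := fun _ => V) κ 0 a).map
        fun X => (Preorder.frestrictLe n X, X (n + 1))) := by
    rw [integral_map (by fun_prop) (measurable_of_finite _).aestronglyMeasurable]
    rfl
  have h2 : ∫ X, (P (X n)).avg (f (X n)) ∂(Kernel.traj (X := fun _ => V) κ 0 a) =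
      ∫ z, (P (z ⟨n, hn⟩)).avg (f (z ⟨n, hn⟩)) ∂((Kernel.traj (X := fun _ => V) κ 0 a).map
        (Preorder.frestrictLe n)) := by
    rw [integral_map (by fun_prop) (measurable_of_finite _).aestronglyMeasurable]
    rfl
  rw [h1, h2, ← Kernel.partialTraj_compProd_eq_map_traj (Nat.zero_le n),
    Kernel.traj_map_frestrictLe_apply, Measure.integral_compProd .of_finite]
  refine integral_congr_ae (Filter.Eventually.of_forall fun z => ?_)
  simp only [hκ, PMF.avg_eq_integral]

lemma integral_traj_zero (κ : ∀ n : ℕ, Kernel (Finset.Iic n → V) V)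
    [∀ n, IsMarkovKernel (κ n)] (x : V) (f : V → ℝ) :
    ∫ X, f (X 0) ∂(Kernel.traj (X := fun _ => V) κ 0 fun _ => x) = f x := by
  have h0 : (0 : ℕ) ∈ Finset.Iic 0 := Finset.mem_Iic.2 le_rfl
  have h1 : ∫ X, f (X 0) ∂(Kernel.traj (X := fun _ => V) κ 0 fun _ => x) =
      ∫ z, f (z ⟨0, h0⟩) ∂((Kernel.traj (X := fun _ => V) κ 0 fun _ => x).map
        (Preorder.frestrictLe 0)) := by
    rw [integral_map (by fun_prop) (measurable_of_finite _).aestronglyMeasurable]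
    rfl
  rw [h1, Kernel.traj_map_frestrictLe_apply, Kernel.partialTraj_self, Kernel.id_apply,
    integral_dirac]

lemma integral_traj_eq_iterAvg (P : V → PMF V) (κ : ∀ n : ℕ, Kernel (Finset.Iic n → V) V)
    [∀ n, IsMarkovKernel (κ n)]
    (hκ : ∀ n h, κ n h = (P (h ⟨n, Finset.mem_Iic.2 le_rfl⟩)).toMeasure)
    (x : V) (n : ℕ) (g : V → ℝ) :
    ∫ X, g (X n) ∂(Kernel.traj (X := fun _ => V) κ 0 fun _ => x) = iterAvg P g n x := by
  induction n generalizing g with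
  | zero => exact integral_traj_zero κ x g
  | succ n ih =>
    rw [integral_traj_step P κ hκ _ n fun _ => g, iterAvg_succ', ← ih]

lemma ae_traj_step (P : V → PMF V) (κ : ∀ n : ℕ, Kernel (Finset.Iic n → V) V)
    [∀ n, IsMarkovKernel (κ n)]
    (hκ : ∀ n h, κ n h = (P (h ⟨n, Finset.mem_Iic.2 le_rfl⟩)).toMeasure)
    (a : Finset.Iic 0 → V) (n : ℕ) :
    ∀ᵐ X ∂(Kernel.traj (X := fun _ => V) κ 0 a), P (X n) (X (n + 1)) ≠ 0 := by
  classical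
  -- The indicator of an impossible transition has conditional mean `0`.
  have h := integral_traj_step P κ hκ a n fun x y => if P x y = 0 then 1 else 0
  have h0 : ∀ x, (P x).avg (fun y => if P x y = 0 then (1 : ℝ) else 0) = 0 := fun x => by
    rw [(P x).avg_congr (w := fun _ => 0) fun y hy => if_neg hy, PMF.avg_const]
  simp only [h0, integral_zero] at h
  rw [integral_eq_zero_iff_of_nonneg (fun X => by dsimp only; split_ifs <;> simp)] at h
  · filter_upwards [h] with X hX h'
    simp [h'] at hX
  · refine Integrable.of_bound (C := 1) ?_ (Filter.Eventually.of_forall fun X => ?_)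
    · exact ((measurable_of_finite (fun z : V × V => if P z.1 z.2 = 0 then (1 : ℝ) else 0)).comp
        (by fun_prop : Measurable fun X : ℕ → V => (X n, X (n + 1)))).aestronglyMeasurable
    · split_ifs <;> simp

end MarkovChain

namespace SSG

/-! ### The value of a pair of strategies as a least fixed point -/

section next

variable {V : Type*} (G : SSG V) (σ : G.MaxStrategy) (τ : G.MinStrategy)

lemma next_of_max (x : {x : V // G.kind x = .max}) : G.next σ τ x.1 = PMF.pure (σ x).1 := by
  obtain ⟨x, hx⟩ := x
  unfold next
  split <;> rename_i h <;> first | rfl | (rw [hx] at h; cases h)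

lemma next_of_min (x : {x : V // G.kind x = .min}) : G.next σ τ x.1 = PMF.pure (τ x).1 := by
  obtain ⟨x, hx⟩ := x
  unfold next
  split <;> rename_i h <;> first | rfl | (rw [hx] at h; cases h)

lemma next_of_random {x : V} (hx : G.kind x = .random) : G.next σ τ x = G.prob x := by
  unfold next
  split <;> rename_i h <;> first | rfl | (rw [hx] at h; cases h)

lemma next_of_sink {x : V} (hx : G.kind x = .sink) : G.next σ τ x = PMF.pure x := by
  unfold next
  split <;> rename_i h <;> first | rfl | (rw [hx] at h; cases h)

open Classical in
/-- The payoff of stopping at `x`. -/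
def sinkVal (x : V) : ℝ := if G.kind x = .sink then G.val x else 0

lemma sinkVal_of_sink {x : V} (hx : G.kind x = .sink) : G.sinkVal x = G.val x := if_pos hx

lemma sinkVal_of_ne {x : V} (hx : G.kind x ≠ .sink) : G.sinkVal x = 0 := if_neg hx

lemma sinkVal_mem (x : V) : G.sinkVal x ∈ Set.Icc (0 : ℝ) 1 := by
  unfold sinkVal
  split_ifs with h
  · exact G.val_mem x h
  · simp

variable {G}

lemma playVal_eq_of_absorbed {X : ℕ → V}
    (hX : ∀ n, G.kind (X n) = .sink → X (n + 1) = X n) {t : ℕ} (ht : G.kind (X t) = .sink) :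
    G.playVal X = G.val (X t) := by
  classical
  have h : ∃ t, G.kind (X t) = .sink := ⟨t, ht⟩
  have key : ∀ n, Nat.find h ≤ n → X n = X (Nat.find h) := by
    intro n hn
    induction n, hn using Nat.le_induction with
    | base => rfl
    | succ n hn ih => rw [hX n (by rw [ih]; exact Nat.find_spec h), ih]
  unfold playVal
  rw [dif_pos h, key t (Nat.find_min' h ht)]

lemma tendsto_sinkVal_of_absorbed {X : ℕ → V}
    (hX : ∀ n, G.kind (X n) = .sink → X (n + 1) = X n) :
    Filter.Tendsto (fun n => G.sinkVal (X n)) Filter.atTop (nhds (G.playVal X)) := by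
  by_cases h : ∃ t, G.kind (X t) = .sink
  · obtain ⟨t, ht⟩ := h
    have key : ∀ n, t ≤ n → X n = X t := by
      intro n hn
      induction n, hn using Nat.le_induction with
      | base => rfl
      | succ n hn ih => rw [hX n (by rw [ih]; exact ht), ih]
    refine tendsto_const_nhds.congr' ?_
    filter_upwards [Filter.eventually_ge_atTop t] with n hn
    rw [key n hn, G.sinkVal_of_sink ht, playVal_eq_of_absorbed hX ht]
  · have h0 : G.playVal X = 0 := dif_neg h
    rw [h0]
    refine tendsto_const_nhds.congr fun n => ?_
    rw [G.sinkVal_of_ne fun hn => h ⟨n, hn⟩]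

end next

section pairVal

variable {V : Type*} [Finite V] (G : SSG V) (σ : G.MaxStrategy) (τ : G.MinStrategy)

/-- Sinks are almost surely absorbing, so the payoff of stopping at time `n` converges to the value
of the play; dominated convergence applies. All later facts about values come from this limit, with
no further measure theory. -/
lemma tendsto_pairVal (x : V) : Filter.Tendsto (fun n => iterAvg (G.next σ τ) G.sinkVal n x)
    Filter.atTop (nhds (G.pairVal σ τ x)) := by
  let : MeasurableSpace V := ⊤
  have hκ : ∀ (n : ℕ) (h : Finset.Iic n → V), G.nextKernel σ τ n h =
    (G.next σ τ (h ⟨n, Finset.mem_Iic.2 le_rfl⟩)).toMeasure := fun n h => rfl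
  have hP : IsProbabilityMeasure (G.playMeasure σ τ x) := by
    unfold playMeasure
    infer_instance
  have h1 : ∀ n, iterAvg (G.next σ τ) G.sinkVal n x =
      ∫ X, G.sinkVal (X n) ∂(G.playMeasure σ τ x) := fun n =>
    (integral_traj_eq_iterAvg (G.next σ τ) (G.nextKernel σ τ) hκ x n G.sinkVal).symm
  simp only [h1]
  refine tendsto_integral_of_dominated_convergence (fun _ => 1) (fun n => ?_)
    (integrable_const _) (fun n => Filter.Eventually.of_forall fun X => ?_) ?_
  · exact ((measurable_of_finite G.sinkVal).comp (measurable_pi_apply n)).aestronglyMeasurable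
  · rw [Real.norm_of_nonneg (G.sinkVal_mem _).1]
    exact (G.sinkVal_mem _).2
  · have h2 : ∀ᵐ X ∂(G.playMeasure σ τ x), ∀ n, G.next σ τ (X n) (X (n + 1)) ≠ 0 :=
      ae_all_iff.2 fun n => ae_traj_step (G.next σ τ) (G.nextKernel σ τ) hκ _ n
    filter_upwards [h2] with X hX
    refine tendsto_sinkVal_of_absorbed fun n hn => ?_
    have h3 := hX n
    rwa [G.next_of_sink σ τ hn, ← PMF.mem_support_iff, PMF.mem_support_pure_iff] at h3

lemma pairVal_sink {x : V} (hx : G.kind x = .sink) : G.pairVal σ τ x = G.val x := by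
  have h : ∀ n, iterAvg (G.next σ τ) G.sinkVal n x = G.val x := by
    intro n
    induction n with
    | zero => exact G.sinkVal_of_sink hx
    | succ n ih => simpa [iterAvg, G.next_of_sink σ τ hx] using ih
  have := G.tendsto_pairVal σ τ x
  simp only [h] at this
  exact tendsto_nhds_unique this tendsto_const_nhds

lemma pairVal_eq_avg (x : V) : G.pairVal σ τ x = (G.next σ τ x).avg (G.pairVal σ τ) :=
  tendsto_nhds_unique ((Filter.tendsto_add_atTop_iff_nat 1).2 (G.tendsto_pairVal σ τ x))
    ((G.next σ τ x).tendsto_avg (G.tendsto_pairVal σ τ))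

lemma pairVal_max (x : {x : V // G.kind x = .max}) :
    G.pairVal σ τ x.1 = G.pairVal σ τ (σ x).1 := by
  rw [pairVal_eq_avg, next_of_max, PMF.avg_pure]

lemma pairVal_min (x : {x : V // G.kind x = .min}) :
    G.pairVal σ τ x.1 = G.pairVal σ τ (τ x).1 := by
  rw [pairVal_eq_avg, next_of_min, PMF.avg_pure]

lemma pairVal_random {x : V} (hx : G.kind x = .random) :
    G.pairVal σ τ x = (G.prob x).avg (G.pairVal σ τ) := by
  rw [pairVal_eq_avg, next_of_random G σ τ hx]

variable {G σ τ}

/-- The value vector of a pair of strategies is the least nonnegative superharmonic vector. -/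
lemma pairVal_le {u : V → ℝ} (h0 : ∀ x, 0 ≤ u x) (hs : ∀ x, G.kind x = .sink → G.val x ≤ u x)
    (hu : ∀ x, G.kind x ≠ .sink → (G.next σ τ x).avg u ≤ u x) (x : V) : G.pairVal σ τ x ≤ u x := by
  have hu' : ∀ x, (G.next σ τ x).avg u ≤ u x := fun x => by
    by_cases hx : G.kind x = .sink
    · rw [G.next_of_sink σ τ hx, PMF.avg_pure]
    · exact hu x hx
  have h : ∀ n x, iterAvg (G.next σ τ) G.sinkVal n x ≤ u x := by
    intro n
    induction n with
    | zero =>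
      intro x
      by_cases hx : G.kind x = .sink
      · exact (G.sinkVal_of_sink hx).trans_le (hs x hx)
      · exact (G.sinkVal_of_ne hx).trans_le (h0 x)
    | succ n ih => exact fun x => (PMF.avg_mono _ fun y _ => ih y).trans (hu' x)
  exact le_of_tendsto' (G.tendsto_pairVal σ τ x) fun n => h n x

lemma pairVal_le_of_kinds {u : V → ℝ} (h0 : ∀ x, 0 ≤ u x)
    (hs : ∀ x, G.kind x = .sink → G.val x ≤ u x)
    (hmax : ∀ x, u (σ x).1 ≤ u x.1) (hmin : ∀ x, u (τ x).1 ≤ u x.1)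
    (hr : ∀ x, G.kind x = .random → (G.prob x).avg u ≤ u x) (x : V) : G.pairVal σ τ x ≤ u x := by
  refine pairVal_le h0 hs (fun x hx => ?_) x
  rcases hk : G.kind x with _ | _ | _ | _
  · rw [G.next_of_max σ τ ⟨x, hk⟩, PMF.avg_pure]
    exact hmax ⟨x, hk⟩
  · rw [G.next_of_min σ τ ⟨x, hk⟩, PMF.avg_pure]
    exact hmin ⟨x, hk⟩
  · rw [G.next_of_random σ τ hk]
    exact hr x hk
  · exact absurd hk hx

/-- A play that starts in a closed set without sinks is worth nothing. -/
lemma pairVal_eq_zero_of_closed {S : Set V} (hS : ∀ x ∈ S, G.kind x ≠ .sink)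
    (hc : ∀ x ∈ S, ∀ y, G.next σ τ x y ≠ 0 → y ∈ S) {x : V} (hx : x ∈ S) :
    G.pairVal σ τ x = 0 := by
  classical
  refine le_antisymm ?_ (G.pairVal_mem σ τ x).1
  -- The value vector set to `0` on `S` is still superharmonic, because `S` is closed and has no
  -- sinks.
  have h := pairVal_le (G := G) (σ := σ) (τ := τ)
    (u := fun y => if y ∈ S then 0 else G.pairVal σ τ y) (fun y => ?_) (fun y hy => ?_)
    (fun y hy => ?_) x
  · simpa [hx] using h
  · split_ifs
    · exact le_rfl
    · exact (G.pairVal_mem σ τ y).1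
  · rw [if_neg fun h => hS y h hy, G.pairVal_sink σ τ hy]
  · split_ifs with hyS
    · rw [PMF.avg_congr (w := fun _ => 0) _ fun z hz => if_pos (hc y hyS z hz), PMF.avg_const]
    · rw [G.pairVal_eq_avg σ τ y]
      refine PMF.avg_mono _ fun z _ => ?_
      split_ifs
      · exact (G.pairVal_mem σ τ z).1
      · exact le_rfl

/-- A subharmonic vector that is not below the value vector is constant and positive on some closed
set without sinks. -/
lemma exists_closed_of_not_le_pairVal {u : V → ℝ}
    (hs : ∀ x, G.kind x = .sink → u x ≤ G.val x)
    (hu : ∀ x, G.kind x ≠ .sink → u x ≤ (G.next σ τ x).avg u)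
    (h : ¬ ∀ x, u x ≤ G.pairVal σ τ x) :
    ∃ (S : Set V) (M : ℝ), 0 < M ∧ S.Nonempty ∧ (∀ x ∈ S, G.kind x ≠ .sink) ∧
      (∀ x ∈ S, u x = M) ∧ ∀ x ∈ S, ∀ y, G.next σ τ x y ≠ 0 → y ∈ S := by
  push Not at h
  obtain ⟨x₀, hx₀⟩ := h
  have : Nonempty V := ⟨x₀⟩
  -- The trap is the set where the subharmonic difference `u - v` is maximal. It is closed by the
  -- maximum principle, hence worth `0`, so `u` itself equals the maximum there.
  obtain ⟨m, hm⟩ := Finite.exists_max fun x => u x - G.pairVal σ τ x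
  have hM : 0 < u m - G.pairVal σ τ m := (sub_pos.2 hx₀).trans_le (hm x₀)
  set M := u m - G.pairVal σ τ m with hMdef
  have hS : ∀ x, u x - G.pairVal σ τ x = M → G.kind x ≠ .sink := fun x hx hk => by
    have := hs x hk
    rw [G.pairVal_sink σ τ hk] at hx
    linarith
  have hc : ∀ x, u x - G.pairVal σ τ x = M → ∀ y, G.next σ τ x y ≠ 0 →
      u y - G.pairVal σ τ y = M := fun x hx y hy => by
    refine PMF.eq_of_le_avg (G.next σ τ x) (u := fun z => u z - G.pairVal σ τ z)
      (fun z _ => hm z) ?_ hy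
    rw [PMF.avg_sub, ← pairVal_eq_avg]
    linarith [hu x (hS x hx)]
  refine ⟨{x | u x - G.pairVal σ τ x = M}, M, hM, ⟨m, rfl⟩, hS, fun x hx => ?_, hc⟩
  have h0 : G.pairVal σ τ x = 0 := pairVal_eq_zero_of_closed hS hc hx
  have hx' : u x - G.pairVal σ τ x = M := hx
  linarith

end pairVal

/-! ### Best responses of MIN -/

section maxVal

variable {V : Type*} (G : SSG V)

variable [Finite V]

lemma maxVal_le_pairVal (σ : G.MaxStrategy) (τ : G.MinStrategy) (x : V) :
    G.maxVal σ x ≤ G.pairVal σ τ x :=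
  ciInf_le (Set.finite_range _).bddBelow τ

lemma pairVal_le_minVal (σ : G.MaxStrategy) (τ : G.MinStrategy) (x : V) :
    G.pairVal σ τ x ≤ G.minVal τ x :=
  le_ciSup (f := fun σ => G.pairVal σ τ x) (Set.finite_range _).bddAbove σ

lemma maxVal_le_optVal (σ : G.MaxStrategy) (x : V) : G.maxVal σ x ≤ G.optVal x :=
  le_ciSup (f := fun σ => G.maxVal σ x) (Set.finite_range _).bddAbove σ

variable {G}

/-- MIN follows successors along which `u` does not increase. That one `τ` serves all starting
vertices is what makes uniform best responses possible. -/
lemma maxVal_le {σ : G.MaxStrategy} {u : V → ℝ} (h0 : ∀ x, 0 ≤ u x)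
    (hs : ∀ x, G.kind x = .sink → G.val x ≤ u x) (hmax : ∀ x, u (σ x).1 ≤ u x.1)
    (hmin : ∀ x, G.kind x = .min → ∃ y, G.Adj x y ∧ u y ≤ u x)
    (hr : ∀ x, G.kind x = .random → (G.prob x).avg u ≤ u x) :
    ∃ τ, ∀ x, G.pairVal σ τ x ≤ u x := by
  choose f hf hu using hmin
  exact ⟨fun x => ⟨f x.1 x.2, hf x.1 x.2⟩,
    pairVal_le_of_kinds h0 hs hmax (fun x => hu x.1 x.2) hr⟩

variable (G)

lemma maxVal_sink (σ : G.MaxStrategy) {x : V} (hx : G.kind x = .sink) :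
    G.maxVal σ x = G.val x := by
  simp only [maxVal, G.pairVal_sink σ _ hx, ciInf_const]

/-- MIN has a best response that is good from all vertices. -/
lemma exists_pairVal_eq_maxVal (σ : G.MaxStrategy) : ∃ τ, G.pairVal σ τ = G.maxVal σ := by
  -- The pointwise infimum over `τ` is itself superharmonic, so a single `τ` attains it everywhere.
  have h := maxVal_le (G := G) (σ := σ) (u := G.maxVal σ) (fun x => (G.maxVal_mem σ x).1)
    (fun x hx => (G.maxVal_sink σ hx).ge) (fun x => ?_) (fun x hx => ?_) (fun x hx => ?_)
  · obtain ⟨τ, hτ⟩ := h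
    exact ⟨τ, funext fun x => le_antisymm (hτ x) (G.maxVal_le_pairVal σ τ x)⟩
  · exact le_ciInf fun τ => (G.maxVal_le_pairVal σ τ _).trans_eq (G.pairVal_max σ τ x).symm
  · have : Nonempty {y // G.Adj x y} := nonempty_subtype.2 (G.exists_adj x (by simp [hx]))
    obtain ⟨y, hy⟩ := Finite.exists_min fun y : {y // G.Adj x y} => G.maxVal σ y.1
    refine ⟨y.1, y.2, le_ciInf fun τ => ?_⟩
    rw [G.pairVal_min σ τ ⟨x, hx⟩]
    exact (hy _).trans (G.maxVal_le_pairVal σ τ _)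
  · refine le_ciInf fun τ => ?_
    rw [G.pairVal_random σ τ hx]
    exact PMF.avg_mono _ fun y _ => G.maxVal_le_pairVal σ τ y

lemma maxVal_max (σ : G.MaxStrategy) (x : {x : V // G.kind x = .max}) :
    G.maxVal σ x.1 = G.maxVal σ (σ x).1 := by
  obtain ⟨τ, hτ⟩ := G.exists_pairVal_eq_maxVal σ
  rw [← hτ, G.pairVal_max σ τ x]

lemma maxVal_random (σ : G.MaxStrategy) {x : V} (hx : G.kind x = .random) :
    G.maxVal σ x = (G.prob x).avg (G.maxVal σ) := by
  obtain ⟨τ, hτ⟩ := G.exists_pairVal_eq_maxVal σ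
  rw [← hτ, G.pairVal_random σ τ hx]

lemma exists_maxVal_min (σ : G.MaxStrategy) {x : V} (hx : G.kind x = .min) :
    ∃ y, G.Adj x y ∧ G.maxVal σ y = G.maxVal σ x := by
  obtain ⟨τ, hτ⟩ := G.exists_pairVal_eq_maxVal σ
  refine ⟨_, (τ ⟨x, hx⟩).2, ?_⟩
  rw [← hτ, ← G.pairVal_min σ τ ⟨x, hx⟩]

/-- Otherwise redirecting a best response at `x` towards `y` would keep all values at most `v_σ` and
push the one at `x` strictly below it. -/
lemma maxVal_min_le (σ : G.MaxStrategy) {x y : V} (hx : G.kind x = .min) (hy : G.Adj x y) :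
    G.maxVal σ x ≤ G.maxVal σ y := by
  classical
  by_contra! hlt
  obtain ⟨τ, hτ⟩ := G.exists_pairVal_eq_maxVal σ
  let τ' : G.MinStrategy := Function.update τ ⟨x, hx⟩ ⟨y, hy⟩
  have hle := pairVal_le_of_kinds (G := G) (σ := σ) (τ := τ') (u := G.maxVal σ)
    (fun x => (G.maxVal_mem σ x).1)
    (fun x hx => (G.maxVal_sink σ hx).ge) (fun x => (G.maxVal_max σ x).ge) (fun z => ?_)
    (fun x hx => (G.maxVal_random σ hx).ge)
  · have h1 := G.maxVal_le_pairVal σ τ' x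
    have h2 := G.pairVal_min σ τ' ⟨x, hx⟩
    have h3 := hle y
    simp only [τ', Function.update_self] at h2
    exact absurd (h1.trans (h2.trans_le h3)) (not_le.2 hlt)
  · by_cases hz : z = ⟨x, hx⟩
    · subst hz
      simpa only [τ', Function.update_self] using hlt.le
    · simp only [τ', Function.update_of_ne hz]
      rw [← hτ, ← G.pairVal_min σ τ z]

variable {G}

/-- The value vector of a MAX strategy is a least fixed point. -/
lemma maxVal_le_of_kinds {σ : G.MaxStrategy} {u : V → ℝ} (h0 : ∀ x, 0 ≤ u x)
    (hs : ∀ x, G.kind x = .sink → G.val x ≤ u x) (hmax : ∀ x, u (σ x).1 ≤ u x.1)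
    (hmin : ∀ x, G.kind x = .min → ∃ y, G.Adj x y ∧ u y ≤ u x)
    (hr : ∀ x, G.kind x = .random → (G.prob x).avg u ≤ u x) (x : V) : G.maxVal σ x ≤ u x := by
  obtain ⟨τ, hτ⟩ := maxVal_le h0 hs hmax hmin hr
  exact (G.maxVal_le_pairVal σ τ x).trans (hτ x)

/-- A MAX strategy is worth nothing on a set without sinks in which MIN can keep the play. -/
lemma maxVal_eq_zero_of_closed {σ : G.MaxStrategy} {S : Set V}
    (hS : ∀ x ∈ S, G.kind x ≠ .sink) (hmax : ∀ x, x.1 ∈ S → (σ x).1 ∈ S)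
    (hmin : ∀ x ∈ S, G.kind x = .min → ∃ y ∈ S, G.Adj x y)
    (hr : ∀ x ∈ S, G.kind x = .random → ∀ y, G.prob x y ≠ 0 → y ∈ S) {x : V} (hx : x ∈ S) :
    G.maxVal σ x = 0 := by
  classical
  have : ∃ τ : G.MinStrategy, ∀ x, x.1 ∈ S → (τ x).1 ∈ S := by
    have h : ∀ x : {x : V // G.kind x = .min}, ∃ y : {y // G.Adj x.1 y}, x.1 ∈ S → y.1 ∈ S :=
      fun x => by
        by_cases hxS : x.1 ∈ S
        · obtain ⟨y, hy, hxy⟩ := hmin x.1 hxS x.2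
          exact ⟨⟨y, hxy⟩, fun _ => hy⟩
        · exact ⟨(Classical.arbitrary G.MinStrategy) x, fun h => absurd h hxS⟩
    choose τ hτ using h
    exact ⟨τ, hτ⟩
  obtain ⟨τ, hτ⟩ := this
  refine le_antisymm ((G.maxVal_le_pairVal σ τ x).trans_eq ?_) (G.maxVal_mem σ x).1
  refine pairVal_eq_zero_of_closed hS (fun z hz y hy => ?_) hx
  rcases hk : G.kind z with _ | _ | _ | _
  · rw [G.next_of_max σ τ ⟨z, hk⟩, ← PMF.mem_support_iff, PMF.mem_support_pure_iff] at hy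
    exact hy ▸ hmax ⟨z, hk⟩ hz
  · rw [G.next_of_min σ τ ⟨z, hk⟩, ← PMF.mem_support_iff, PMF.mem_support_pure_iff] at hy
    exact hy ▸ hτ ⟨z, hk⟩ hz
  · rw [G.next_of_random σ τ hk] at hy
    exact hr z hz hk y hy
  · exact absurd hk (hS z hz)

/-- If a vector is subharmonic for a MAX strategy whatever MIN does, it is either a lower bound of
the value of the strategy, or constant and positive on a set without sinks in which MIN can
keep the play. -/
lemma exists_closed_of_not_le_maxVal {σ : G.MaxStrategy} {u : V → ℝ}
    (hs : ∀ x, G.kind x = .sink → u x ≤ G.val x) (hmax : ∀ x, u x.1 ≤ u (σ x).1)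
    (hmin : ∀ x y, G.kind x = .min → G.Adj x y → u x ≤ u y)
    (hr : ∀ x, G.kind x = .random → u x ≤ (G.prob x).avg u)
    (h : ¬ ∀ x, u x ≤ G.maxVal σ x) :
    ∃ (S : Set V) (M : ℝ), 0 < M ∧ S.Nonempty ∧ (∀ x ∈ S, G.kind x ≠ .sink) ∧
      (∀ x ∈ S, u x = M) ∧ (∀ x, x.1 ∈ S → (σ x).1 ∈ S) ∧
      (∀ x ∈ S, G.kind x = .min → ∃ y ∈ S, G.Adj x y) ∧
      ∀ x ∈ S, G.kind x = .random → ∀ y, G.prob x y ≠ 0 → y ∈ S := by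
  obtain ⟨τ, hτ⟩ := G.exists_pairVal_eq_maxVal σ
  rw [← hτ] at h
  have key := exists_closed_of_not_le_pairVal hs (fun x hx => ?_) h
  · obtain ⟨S, M, hM, hne, hS, hu, hc⟩ := key
    refine ⟨S, M, hM, hne, hS, hu, fun x hx => ?_, fun x hx hk => ?_, fun x hx hk y hy => ?_⟩
    · refine hc x.1 hx _ ?_
      rw [G.next_of_max σ τ x, ← PMF.mem_support_iff, PMF.mem_support_pure_iff]
    · refine ⟨(τ ⟨x, hk⟩).1, hc x hx _ ?_, (τ ⟨x, hk⟩).2⟩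
      rw [G.next_of_min σ τ ⟨x, hk⟩, ← PMF.mem_support_iff, PMF.mem_support_pure_iff]
    · refine hc x hx y ?_
      rwa [G.next_of_random σ τ hk]
  · rcases hk : G.kind x with _ | _ | _ | _
    · rw [G.next_of_max σ τ ⟨x, hk⟩, PMF.avg_pure]
      exact hmax ⟨x, hk⟩
    · rw [G.next_of_min σ τ ⟨x, hk⟩, PMF.avg_pure]
      exact hmin x _ hk (τ ⟨x, hk⟩).2
    · rw [G.next_of_random σ τ hk]
      exact hr x hk
    · exact absurd hk hx

/-! ### Strategy improvement -/

/-- Switching a MAX strategy only where this is a strict improvement does not decrease its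
values. -/
lemma maxVal_mono_of_switch {σ σ' : G.MaxStrategy}
    (hle : ∀ x, G.maxVal σ x.1 ≤ G.maxVal σ (σ' x).1)
    (heq : ∀ x, G.maxVal σ (σ' x).1 = G.maxVal σ x.1 → σ' x = σ x) (x : V) :
    G.maxVal σ x ≤ G.maxVal σ' x := by
  by_contra hx
  obtain ⟨S, M, hM, ⟨z, hz⟩, hS, hu, h1, h2, h3⟩ := exists_closed_of_not_le_maxVal (G := G)
    (σ := σ') (u := G.maxVal σ) (fun x hx => (G.maxVal_sink σ hx).le) hle
    (fun x y hx hy => G.maxVal_min_le σ hx hy) (fun x hx => (G.maxVal_random σ hx).le)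
    (fun h => hx (h x))
  -- On the trap `v_σ` is constant, so no switch was made there and MIN can already trap `σ`; thus
  -- `v_σ = 0`, against `M > 0`.
  have h0 : G.maxVal σ z = 0 := maxVal_eq_zero_of_closed hS (fun x hx => by
    rw [← heq x ((hu _ (h1 x hx)).trans (hu _ hx).symm)]
    exact h1 x hx) h2 h3 hz
  exact hM.ne' ((hu z hz).symm.trans h0)

/-- A MAX strategy without improving switches is optimal. -/
lemma maxVal_eq_optVal {σ : G.MaxStrategy}
    (h : ∀ x y, G.kind x = .max → G.Adj x y → G.maxVal σ y ≤ G.maxVal σ x) :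
    G.maxVal σ = G.optVal := by
  refine funext fun x => le_antisymm (G.maxVal_le_optVal σ x) (ciSup_le fun σ' => ?_)
  exact maxVal_le_of_kinds (fun x => (G.maxVal_mem σ x).1)
    (fun x hx => (G.maxVal_sink σ hx).ge) (fun x => h x.1 _ x.2 (σ' x).2)
    (fun x hx => (G.exists_maxVal_min σ hx).imp fun y hy => ⟨hy.1, hy.2.le⟩)
    (fun x hx => (G.maxVal_random σ hx).ge) x

/-- A single improving switch strictly increases the value at the vertex where it is made. -/
lemma exists_switch {σ : G.MaxStrategy} {x y : V} (hx : G.kind x = .max) (hy : G.Adj x y)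
    (hlt : G.maxVal σ x < G.maxVal σ y) : ∃ σ' : G.MaxStrategy,
      (∀ z, z ≠ ⟨x, hx⟩ → σ' z = σ z) ∧ (∀ z, G.maxVal σ z ≤ G.maxVal σ' z) ∧
      G.maxVal σ x < G.maxVal σ' x := by
  classical
  let σ' : G.MaxStrategy := Function.update σ ⟨x, hx⟩ ⟨y, hy⟩
  have hx' : σ' ⟨x, hx⟩ = ⟨y, hy⟩ := Function.update_self ..
  have hne : ∀ z, z ≠ ⟨x, hx⟩ → σ' z = σ z := fun z hz => Function.update_of_ne hz ..
  have hmono : ∀ z, G.maxVal σ z ≤ G.maxVal σ' z := by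
    refine maxVal_mono_of_switch (fun z => ?_) fun z hz => ?_
    · by_cases h : z = ⟨x, hx⟩
      · rw [h, hx']
        exact hlt.le
      · rw [hne z h, ← G.maxVal_max σ z]
    · by_cases h : z = ⟨x, hx⟩
      · rw [h, hx'] at hz
        exact absurd hz hlt.ne'
      · exact hne z h
  refine ⟨σ', hne, hmono, ?_⟩
  rw [G.maxVal_max σ' ⟨x, hx⟩, hx']
  exact hlt.trans_le (hmono y)

variable (G)

/-- Strategy improvement from `σ` leads to an optimal strategy that differs from `σ` only where the
value has increased. -/
lemma exists_maxVal_eq_optVal (σ : G.MaxStrategy) : ∃ σ' : G.MaxStrategy,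
    G.maxVal σ' = G.optVal ∧ ∀ x, G.maxVal σ' x.1 = G.maxVal σ x.1 → σ' x = σ x := by
  classical
  let P : Set G.MaxStrategy := {σ' | (∀ x, G.maxVal σ x ≤ G.maxVal σ' x) ∧
    ∀ x, G.maxVal σ' x.1 = G.maxVal σ x.1 → σ' x = σ x}
  -- A maximal element of `P` admits no improving switch: such a switch would stay in `P`, since the
  -- value at the switched vertex then exceeds that of `σ`.
  obtain ⟨σ', ⟨hle, heq⟩, hmax⟩ := P.toFinite.exists_maximalFor G.maxVal P
    ⟨σ, fun _ => le_rfl, fun _ _ => rfl⟩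
  refine ⟨σ', maxVal_eq_optVal fun x y hx hy => ?_, heq⟩
  by_contra! hlt
  obtain ⟨σ'', hne, hmono, hxlt⟩ := exists_switch hx hy hlt
  have hmem : σ'' ∈ P := by
    refine ⟨fun z => (hle z).trans (hmono z), fun z hz => ?_⟩
    by_cases h : z = ⟨x, hx⟩
    · rw [h] at hz
      exact absurd hz ((hle x).trans_lt hxlt).ne'
    · rw [hne z h]
      exact heq z (le_antisymm ((hmono z.1).trans_eq hz) (hle z.1))
  exact absurd (hmax hmem hmono x) (not_le.2 hxlt)

lemma optVal_sink {x : V} (hx : G.kind x = .sink) : G.optVal x = G.val x := by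
  obtain ⟨σ, hσ, -⟩ := G.exists_maxVal_eq_optVal (Classical.arbitrary _)
  rw [← hσ, G.maxVal_sink σ hx]

lemma optVal_random {x : V} (hx : G.kind x = .random) :
    G.optVal x = (G.prob x).avg G.optVal := by
  obtain ⟨σ, hσ, -⟩ := G.exists_maxVal_eq_optVal (Classical.arbitrary _)
  rw [← hσ, G.maxVal_random σ hx]

lemma exists_optVal_min {x : V} (hx : G.kind x = .min) :
    ∃ y, G.Adj x y ∧ G.optVal y = G.optVal x := by
  obtain ⟨σ, hσ, -⟩ := G.exists_maxVal_eq_optVal (Classical.arbitrary _)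
  rw [← hσ]
  exact G.exists_maxVal_min σ hx

lemma optVal_le_max {x y : V} (hx : G.kind x = .max) (hy : G.Adj x y) :
    G.optVal y ≤ G.optVal x := by
  obtain ⟨σ, hσ, -⟩ := G.exists_maxVal_eq_optVal (Classical.arbitrary _)
  by_contra! hlt
  rw [← hσ] at hlt
  obtain ⟨σ', -, -, hxlt⟩ := exists_switch hx hy hlt
  rw [hσ] at hxlt
  exact absurd (G.maxVal_le_optVal σ' x) (not_le.2 hxlt)

variable {G}

/-- The optimal value vector is a least fixed point. -/
lemma optVal_le_of_kinds {u : V → ℝ} (h0 : ∀ x, 0 ≤ u x)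
    (hs : ∀ x, G.kind x = .sink → G.val x ≤ u x)
    (hmax : ∀ x y, G.kind x = .max → G.Adj x y → u y ≤ u x)
    (hmin : ∀ x, G.kind x = .min → ∃ y, G.Adj x y ∧ u y ≤ u x)
    (hr : ∀ x, G.kind x = .random → (G.prob x).avg u ≤ u x) (x : V) : G.optVal x ≤ u x :=
  ciSup_le fun σ => maxVal_le_of_kinds h0 hs (fun x => hmax x.1 _ x.2 (σ x).2) hmin hr x

/-- The MIN half of the pair moves along successors of equal optimal value. Then `optVal` is
superharmonic against every MAX strategy, so no strategy improvement for MIN is needed. -/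
lemma isOptimal_iff {σ : G.MaxStrategy} : G.IsOptimal σ ↔ G.maxVal σ = G.optVal := by
  refine ⟨fun ⟨τ, _, h, _⟩ => h, fun h => ?_⟩
  have hmin : ∀ x : {x : V // G.kind x = .min}, ∃ y : {y // G.Adj x.1 y},
      G.optVal y.1 = G.optVal x.1 := fun x => by
    obtain ⟨y, hy, hxy⟩ := G.exists_optVal_min x.2
    exact ⟨⟨y, hy⟩, hxy⟩
  choose τ hτ using hmin
  have h1 : ∀ x, G.minVal τ x ≤ G.optVal x := fun x => ciSup_le fun σ' =>
    pairVal_le_of_kinds (fun x => (G.optVal_mem x).1) (fun x hx => (G.optVal_sink hx).ge)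
      (fun x => G.optVal_le_max x.2 (σ' x).2) (fun x => (hτ x).le)
      (fun x hx => (G.optVal_random hx).ge) x
  have h2 : ∀ x, G.optVal x ≤ G.pairVal σ τ x := fun x => by
    rw [← h]
    exact G.maxVal_le_pairVal σ τ x
  exact ⟨τ, funext fun x => le_antisymm ((G.pairVal_le_minVal σ τ x).trans (h1 x)) (h2 x), h,
    funext fun x => le_antisymm (h1 x) ((h2 x).trans (G.pairVal_le_minVal σ τ x))⟩

end maxVal

/-! ### Redirecting arcs out of random vertices -/

section transform

variable {V : Type*} (G : SSG V) {A : Set G.Arc}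

/-- Every use of `A ⊆ R` comes down to this: the choices of both players are untouched. -/
lemma redirect_of_ne_random (hA : A ⊆ G.randomArcs) {x : V} (hx : G.kind x ≠ .random) (y : V) :
    G.redirect A x y = .inl y := by
  unfold redirect
  rw [dif_neg]
  rintro ⟨e, he⟩
  have h : G.kind e.1.1.1 = .random := hA e.2
  rw [he] at h
  exact hx h

lemma redirect_cases (x y : V) : G.redirect A x y = .inl y ∨
    ∃ e : A, e.1.1 = (x, y) ∧ G.redirect A x y = .inr e := by
  unfold redirect
  split_ifs with h
  · exact .inr ⟨h.choose, h.choose_spec, rfl⟩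
  · exact .inl rfl

lemma redirect_randomArcs {x y : V} (hx : G.kind x = .random) (hy : G.Adj x y) :
    ∃ e : G.randomArcs, e.1.1 = (x, y) ∧ G.redirect G.randomArcs x y = .inr e := by
  have h : ∃ e : G.randomArcs, e.1.1 = (x, y) :=
    ⟨⟨⟨(x, y), hy, by rw [hx]; exact VertexKind.noConfusion⟩, hx⟩, rfl⟩
  unfold redirect
  rw [dif_pos h]
  exact ⟨h.choose, h.choose_spec, rfl⟩

lemma transform_adj_of_ne_random (hA : A ⊆ G.randomArcs) (f : A → Set.Icc (0 : ℝ) 1) {x y : V}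
    (hx : G.kind x ≠ .random) : (G.transform A f).Adj (.inl x) (.inl y) ↔ G.Adj x y := by
  constructor
  · rintro ⟨z, hz, h⟩
    rw [G.redirect_of_ne_random hA hx] at h
    rwa [Sum.inl.inj h]
  · exact fun h => ⟨y, h, (G.redirect_of_ne_random hA hx y).symm⟩

lemma exists_of_transform_adj (hA : A ⊆ G.randomArcs) (f : A → Set.Icc (0 : ℝ) 1) {x : V}
    {z : V ⊕ A} (hx : G.kind x ≠ .random) (h : (G.transform A f).Adj (.inl x) z) :
    ∃ y, G.Adj x y ∧ z = .inl y := by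
  obtain ⟨y, hy, rfl⟩ := h
  exact ⟨y, hy, G.redirect_of_ne_random hA hx y⟩

lemma liftStrategy_apply (hA : A ⊆ G.randomArcs) (f : A → Set.Icc (0 : ℝ) 1) (σ : G.MaxStrategy)
    (x : {x : V // G.kind x = .max}) :
    (G.liftStrategy A f σ ⟨.inl x.1, x.2⟩).1 = .inl (σ x).1 :=
  G.redirect_of_ne_random hA (by rw [x.2]; exact VertexKind.noConfusion) _

lemma liftStrategy_surjective (hA : A ⊆ G.randomArcs) (f : A → Set.Icc (0 : ℝ) 1) :
    Function.Surjective (G.liftStrategy A f) := by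
  intro ρ
  have h : ∀ x : {x : V // G.kind x = .max}, ∃ y : {y // G.Adj x.1 y},
      (ρ ⟨.inl x.1, x.2⟩).1 = .inl y.1 := fun x => by
    obtain ⟨y, hy, h⟩ := G.exists_of_transform_adj hA f
      (by rw [x.2]; exact VertexKind.noConfusion) (ρ ⟨.inl x.1, x.2⟩).2
    exact ⟨⟨y, hy⟩, h⟩
  choose σ hσ using h
  refine ⟨σ, funext ?_⟩
  rintro ⟨x | e, hx⟩
  · exact Subtype.ext ((G.liftStrategy_apply hA f σ ⟨x, hx⟩).trans (hσ ⟨x, hx⟩).symm)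
  · exact absurd hx VertexKind.noConfusion

lemma eq_of_liftStrategy_eq (hA : A ⊆ G.randomArcs) (f : A → Set.Icc (0 : ℝ) 1)
    {σ σ' : G.MaxStrategy} {x : {x : V // G.kind x = .max}}
    (h : G.liftStrategy A f σ' ⟨.inl x.1, x.2⟩ = G.liftStrategy A f σ ⟨.inl x.1, x.2⟩) :
    σ' x = σ x := by
  have := congrArg Subtype.val h
  rw [G.liftStrategy_apply hA, G.liftStrategy_apply hA] at this
  exact Subtype.ext (Sum.inl.inj this)

variable [Finite V]

lemma avg_transform_prob (f : A → Set.Icc (0 : ℝ) 1) (x : V) (g : V ⊕ A → ℝ) :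
    ((G.transform A f).prob (.inl x)).avg g = (G.prob x).avg fun y => g (G.redirect A x y) :=
  PMF.avg_map _ _ _

lemma maxVal_transform_inr (f : A → Set.Icc (0 : ℝ) 1) (σ : (G.transform A f).MaxStrategy) (e : A) :
    (G.transform A f).maxVal σ (.inr e) = f e :=
  maxVal_sink _ σ (x := .inr e) rfl

lemma maxVal_transform_random (f : A → Set.Icc (0 : ℝ) 1) (σ : (G.transform A f).MaxStrategy)
    {x : V} (hx : G.kind x = .random) : (G.transform A f).maxVal σ (.inl x) =
      (G.prob x).avg fun y => (G.transform A f).maxVal σ (G.redirect A x y) :=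
  (maxVal_random _ σ (x := .inl x) hx).trans (G.avg_transform_prob f x _)

/-- The value of a strategy does not change when arcs are redirected according to its values. -/
lemma maxVal_transform_arcVal (hA : A ⊆ G.randomArcs) (σ : G.MaxStrategy) (x : V) :
    (G.transform A (G.arcVal A σ)).maxVal (G.liftStrategy A (G.arcVal A σ) σ) (.inl x) =
      G.maxVal σ x := by
  set H := G.transform A (G.arcVal A σ)
  set ρ := G.liftStrategy A (G.arcVal A σ) σ with hρ
  -- The values of `σ`, extended by the new sinks, satisfy the equations of the transformed game.
  -- This bound is then used for the converse: a redirected arc pays `v_σ y`, which is at least the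
  -- transformed value at `y`.
  have h1 : ∀ z, H.maxVal ρ z ≤ Sum.elim (G.maxVal σ) (fun e => (G.arcVal A σ e : ℝ)) z := by
    refine maxVal_le_of_kinds ?_ ?_ ?_ ?_ ?_
    · rintro (x | e)
      · exact (G.maxVal_mem σ x).1
      · exact (G.arcVal A σ e).2.1
    · rintro (x | e) hx
      · exact (G.maxVal_sink σ hx).ge
      · exact le_rfl
    · rintro ⟨x | e, hx⟩
      · rw [hρ, G.liftStrategy_apply hA _ σ ⟨x, hx⟩]
        exact (G.maxVal_max σ ⟨x, hx⟩).ge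
      · exact absurd hx VertexKind.noConfusion
    · rintro (x | e) hx
      · obtain ⟨y, hy, hxy⟩ := G.exists_maxVal_min σ hx
        exact ⟨.inl y, (G.transform_adj_of_ne_random hA _ (by
          change G.kind x = _ at hx; rw [hx]; exact VertexKind.noConfusion)).2 hy, hxy.le⟩
      · exact absurd hx VertexKind.noConfusion
    · rintro (x | e) hx
      · rw [show (H.prob (.inl x)).avg _ = _ from G.avg_transform_prob _ x _]
        refine le_of_eq ((PMF.avg_congr _ fun y _ => ?_).trans (G.maxVal_random σ hx).symm)
        rcases G.redirect_cases (A := A) x y with h | ⟨e, he, h⟩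
        · rw [h, Sum.elim_inl]
        · rw [h, Sum.elim_inr]
          simp only [arcVal, he]
      · exact absurd hx VertexKind.noConfusion
  refine le_antisymm (h1 (.inl x)) ?_
  refine maxVal_le_of_kinds (u := fun x => H.maxVal ρ (.inl x)) (fun x => (H.maxVal_mem ρ _).1)
    (fun x hx => (H.maxVal_sink ρ (x := .inl x) hx).ge) (fun x => ?_) (fun x hx => ?_)
    (fun x hx => ?_) x
  · rw [H.maxVal_max ρ ⟨.inl x.1, x.2⟩, hρ, G.liftStrategy_apply hA]
  · obtain ⟨z, hz, hxz⟩ := H.exists_maxVal_min ρ (x := .inl x) hx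
    obtain ⟨y, hy, rfl⟩ := G.exists_of_transform_adj hA _
      (by rw [hx]; exact VertexKind.noConfusion) hz
    exact ⟨y, hy, hxz.le⟩
  · rw [show H.maxVal ρ (.inl x) = _ from G.maxVal_transform_random _ ρ hx]
    refine PMF.avg_mono _ fun y _ => ?_
    rcases G.redirect_cases (A := A) x y with h | ⟨e, he, h⟩
    · rw [h]
    · rw [h, maxVal_transform_inr]
      simpa only [arcVal, he, Sum.elim_inl] using h1 (.inl y)

/-- If no strategy improves on `σ` once arcs are redirected according to the values of `σ`, then
`σ` is optimal. -/
lemma isOptimal_of_transform (hA : A ⊆ G.randomArcs) (σ : G.MaxStrategy)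
    (h : (G.transform A (G.arcVal A σ)).maxVal (G.liftStrategy A (G.arcVal A σ) σ) =
      (G.transform A (G.arcVal A σ)).optVal) : G.IsOptimal σ := by
  refine isOptimal_iff.2 (maxVal_eq_optVal fun x y hx hy => ?_)
  have h1 := (G.transform A (G.arcVal A σ)).optVal_le_max (x := .inl x) (y := .inl y) hx
    ((G.transform_adj_of_ne_random hA _ (by rw [hx]; exact VertexKind.noConfusion)).2 hy)
  rwa [← h, G.maxVal_transform_arcVal hA, G.maxVal_transform_arcVal hA] at h1

/-- Strategy improvement inside `G[A, σ]` gives the new strategy; if it gained nothing, `σ` would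
already be optimal in `G`. -/
lemma exists_optGSIAStep (hA : A ⊆ G.randomArcs) (σ : G.MaxStrategy) (hσ : ¬ G.IsOptimal σ) :
    ∃ σ', G.OptGSIAStep A σ σ' := by
  obtain ⟨ρ, hρ, heq⟩ := (G.transform A (G.arcVal A σ)).exists_maxVal_eq_optVal
    (G.liftStrategy A (G.arcVal A σ) σ)
  obtain ⟨σ', rfl⟩ := G.liftStrategy_surjective hA (G.arcVal A σ) ρ
  refine ⟨σ', isOptimal_iff.2 hρ, lt_of_le_of_ne (fun x => ?_) fun h => ?_, heq⟩
  · rw [hρ]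
    exact maxVal_le_optVal _ _ x
  · exact hσ (G.isOptimal_of_transform hA σ (h.trans hρ))

variable {G} in
/-- The strategy found by a step is worth at least as much in the game itself as in the game with
redirected arcs. -/
lemma OptGSIAStep.optVal_le (hA : A ⊆ G.randomArcs) {σ σ' : G.MaxStrategy}
    (h : G.OptGSIAStep A σ σ') (x : V) :
    (G.transform A (G.arcVal A σ)).optVal (.inl x) ≤ G.maxVal σ' x := by
  obtain ⟨hopt, ⟨hlt, heq⟩⟩ := h
  rw [← isOptimal_iff.1 hopt]
  set H := G.transform A (G.arcVal A σ)
  set ρ := G.liftStrategy A (G.arcVal A σ) σ' with hρ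
  have hle : ∀ x, G.maxVal σ x ≤ H.maxVal ρ (.inl x) := fun x => by
    rw [← G.maxVal_transform_arcVal hA]
    exact hlt.le _
  -- Undoing the redirection can only raise what a random vertex sees, so the transformed values of
  -- `σ'` are subharmonic in `G`.
  have hred : ∀ x y, H.maxVal ρ (G.redirect A x y) ≤ H.maxVal ρ (.inl y) := fun x y => by
    rcases G.redirect_cases (A := A) x y with h | ⟨e, he, h⟩
    · rw [h]
    · rw [h, maxVal_transform_inr]
      simpa only [arcVal, he] using hle y
  by_contra hx
  obtain ⟨S, M, hM, ⟨z, hz⟩, hS, hu, h1, h2, h3⟩ := exists_closed_of_not_le_maxVal (G := G)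
    (σ := σ') (u := fun x => H.maxVal ρ (.inl x))
    (fun x hx => (H.maxVal_sink ρ (x := .inl x) hx).le)
    (fun x => by rw [H.maxVal_max ρ ⟨.inl x.1, x.2⟩, hρ, G.liftStrategy_apply hA])
    (fun x y hx hy => H.maxVal_min_le ρ (x := .inl x) hx
      ((G.transform_adj_of_ne_random hA _ (by rw [hx]; exact VertexKind.noConfusion)).2 hy))
    (fun x hx => by
      rw [show H.maxVal ρ (.inl x) = _ from G.maxVal_transform_random _ ρ hx]
      exact PMF.avg_mono _ fun y _ => hred x y)
    (fun h => hx (h x))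
  -- Where `v_σ = M` inside the trap the value did not change, so `σ'` agrees with `σ`. As `v_σ ≤ M`
  -- on `S`, these vertices form a trap for `σ`, which forces `v_σ = 0`.
  have hS' : ∀ x ∈ S, G.maxVal σ x ≠ M := by
    intro x hxS hxM
    have h0 : G.maxVal σ x = 0 := by
      refine maxVal_eq_zero_of_closed (S := {x ∈ S | G.maxVal σ x = M}) (fun x hx => hS x hx.1)
        (fun x hx => ?_) (fun x hx hk => ?_) (fun x hx hk y hy => ?_) ⟨hxS, hxM⟩
      · have h4 : σ' x = σ x := G.eq_of_liftStrategy_eq hA _ (heq ⟨.inl x.1, x.2⟩ (by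
          rw [G.maxVal_transform_arcVal hA, hx.2]
          exact hu _ hx.1))
        refine ⟨h4 ▸ h1 x hx.1, ?_⟩
        rw [← G.maxVal_max σ x, hx.2]
      · obtain ⟨y, hyS, hy⟩ := h2 x hx.1 hk
        exact ⟨y, ⟨hyS, le_antisymm ((hle y).trans_eq (hu y hyS))
          (hx.2.symm.trans_le (G.maxVal_min_le σ hk hy))⟩, hy⟩
      · refine ⟨h3 x hx.1 hk y hy, PMF.eq_of_le_avg (G.prob x) (fun w hw =>
          (hle w).trans_eq (hu w (h3 x hx.1 hk w hw))) ?_ hy⟩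
        rw [← G.maxVal_random σ hk, hx.2]
    exact hM.ne' (hxM.symm.trans h0)
  -- No redirected arc leaves `S`: its sink would have to be worth `M`, hence `v_σ = M` at its end
  -- vertex in `S`, which was excluded. So `S` is also a trap in the transformed game, against `M >
  -- 0`.
  have h0 : H.maxVal ρ (.inl z) = 0 := by
    refine maxVal_eq_zero_of_closed (S := Sum.inl '' S) ?_ ?_ ?_ ?_ ⟨z, hz, rfl⟩
    · rintro _ ⟨x, hx, rfl⟩
      exact hS x hx
    · rintro ⟨_, hk⟩ ⟨x, hx, rfl⟩
      rw [hρ, G.liftStrategy_apply hA _ σ' ⟨x, hk⟩]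
      exact ⟨_, h1 ⟨x, hk⟩ hx, rfl⟩
    · rintro _ ⟨x, hx, rfl⟩ hk
      obtain ⟨y, hyS, hy⟩ := h2 x hx hk
      exact ⟨_, ⟨y, hyS, rfl⟩, (G.transform_adj_of_ne_random hA _ (by
        change G.kind x = _ at hk; rw [hk]; exact VertexKind.noConfusion)).2 hy⟩
    · rintro _ ⟨x, hx, rfl⟩ hk w hw
      have hk' : G.kind x = .random := hk
      have hw' : w ∈ ((G.prob x).map (G.redirect A x)).support := hw
      obtain ⟨y, hy, rfl⟩ := (PMF.mem_support_map_iff _ _ _).1 hw'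
      have hyS := h3 x hx hk' y hy
      rcases G.redirect_cases (A := A) x y with h | ⟨e, he, h⟩
      · exact ⟨y, hyS, h.symm⟩
      · refine absurd ?_ (hS' y hyS)
        have h4 := PMF.eq_of_le_avg (G.prob x) (u := fun y => H.maxVal ρ (G.redirect A x y))
          (M := M) (fun w hw => (hred x w).trans_eq (hu w (h3 x hx hk' w hw))) (by
            exact (hu x hx).symm.trans_le (G.maxVal_transform_random _ ρ hk').le) hy
        rw [h, maxVal_transform_inr] at h4
        simpa only [arcVal, he] using h4
  exact hM.ne' ((hu z hz).symm.trans h0)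

variable {G} in
lemma OptGSIAStep.maxVal_lt (hA : A ⊆ G.randomArcs) {σ σ' : G.MaxStrategy}
    (h : G.OptGSIAStep A σ σ') : G.maxVal σ < G.maxVal σ' := by
  have h1 := h.2.1
  have h2 : ∀ x, (G.transform A (G.arcVal A σ)).maxVal
      (G.liftStrategy A (G.arcVal A σ) σ') (.inl x) ≤ G.maxVal σ' x := fun x =>
    (maxVal_le_optVal _ _ _).trans (h.optVal_le hA x)
  obtain ⟨h3, z, hz⟩ := Pi.lt_def.1 h1
  refine Pi.lt_def.2 ⟨fun x => ?_, ?_⟩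
  · rw [← G.maxVal_transform_arcVal hA]
    exact (h3 _).trans (h2 x)
  · rcases z with x | e
    · rw [G.maxVal_transform_arcVal hA] at hz
      exact ⟨x, hz.trans_le (h2 x)⟩
    · rw [maxVal_transform_inr, maxVal_transform_inr] at hz
      exact absurd hz (lt_irrefl _)

/-- The values of the deterministic game are bounded by any vector that solves the optimality
equations at the vertices that are not random and dominates the given values at the others. -/
lemma detVal_le {w : G.RandomVertex → Set.Icc (0 : ℝ) 1} {u : V → ℝ} (h0 : ∀ x, 0 ≤ u x)
    (hs : ∀ x, G.kind x = .sink → G.val x ≤ u x)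
    (hmax : ∀ x y, G.kind x = .max → G.Adj x y → u y ≤ u x)
    (hmin : ∀ x, G.kind x = .min → ∃ y, G.Adj x y ∧ u y ≤ u x)
    (hr : ∀ x : G.RandomVertex, (w x : ℝ) ≤ u x.1) (x : V) : G.detVal w x ≤ u x := by
  have hA : G.randomArcs ⊆ G.randomArcs := subset_rfl
  refine optVal_le_of_kinds (u := Sum.elim u fun e : G.randomArcs => (w ⟨e.1.1.1, e.2⟩ : ℝ))
    ?_ ?_ ?_ ?_ ?_ (.inl x)
  · rintro (x | e)
    · exact h0 x
    · exact (w _).2.1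
  · rintro (x | e) hx
    · exact hs x hx
    · exact le_rfl
  · rintro (x | e) z hx hz
    · obtain ⟨y, hy, rfl⟩ := G.exists_of_transform_adj hA _ (by
        change G.kind x = _ at hx; rw [hx]; exact VertexKind.noConfusion) hz
      exact hmax x y hx hy
    · exact absurd hx VertexKind.noConfusion
  · rintro (x | e) hx
    · obtain ⟨y, hy, hxy⟩ := hmin x hx
      exact ⟨.inl y, (G.transform_adj_of_ne_random hA _ (by
        change G.kind x = _ at hx; rw [hx]; exact VertexKind.noConfusion)).2 hy, hxy⟩
    · exact absurd hx VertexKind.noConfusion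
  · rintro (x | e) hx
    · have hx' : G.kind x = .random := hx
      rw [avg_transform_prob]
      refine (PMF.avg_mono (w := fun _ => u x) _ fun y hy => ?_).trans_eq (PMF.avg_const _ _)
      obtain ⟨e, he, h⟩ := G.redirect_randomArcs hx' ((G.prob_ne_zero_iff x hx' y).1 hy)
      rw [h, Sum.elim_inr]
      have := hr ⟨e.1.1.1, e.2⟩
      exact this.trans_eq (congrArg u (congrArg Prod.fst he))
    · exact absurd hx VertexKind.noConfusion

end transform

end SSG

/-! ### Determinants of substochastic systems -/

/-- Gaussian elimination of state `0`, with pivot `c = 1 - Q 0 0`, leaves `1 - Q'`, where `Q'` is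
the chain watched off state `0` and is again substochastic; so the determinant is a product of
pivots in `[0, 1]`. If `c = 0`, row `0` of `1 - Q` vanishes. -/
lemma Matrix.det_one_sub_mem_Icc_fin (n : ℕ) (Q : Matrix (Fin n) (Fin n) ℝ)
    (h0 : ∀ i j, 0 ≤ Q i j) (h1 : ∀ i, ∑ j, Q i j ≤ 1) : (1 - Q).det ∈ Set.Icc (0 : ℝ) 1 := by
  induction n with
  | zero => simp
  | succ n ih =>
    have hrow : ∀ i, Q i 0 + ∑ j : Fin n, Q i j.succ ≤ 1 := fun i => by
      rw [← Fin.sum_univ_succ]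
      exact h1 i
    have hnn : ∀ i, 0 ≤ ∑ j : Fin n, Q i j.succ := fun i => Finset.sum_nonneg fun j _ => h0 i _
    rcases (show 0 ≤ 1 - Q 0 0 by linarith [hrow 0, hnn 0]).eq_or_lt with hc | hc
    · have hz : ∀ j : Fin n, Q 0 j.succ = 0 := fun j =>
        (Finset.sum_eq_zero_iff_of_nonneg fun j _ => h0 0 j.succ).1
          (le_antisymm (by linarith [hrow 0]) (hnn 0)) j (Finset.mem_univ j)
      rw [Matrix.det_eq_zero_of_row_eq_zero 0]
      · simp
      · intro j
        refine Fin.cases ?_ (fun j => ?_) j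
        · simpa using hc.symm
        · simp [hz j, (Fin.succ_ne_zero j).symm]
    · set c := 1 - Q 0 0 with hcdef
      let Q' : Matrix (Fin n) (Fin n) ℝ :=
        Matrix.of fun i j => Q i.succ j.succ + Q i.succ 0 / c * Q 0 j.succ
      have hQ' := ih Q' (fun i j => add_nonneg (h0 _ _)
        (mul_nonneg (div_nonneg (h0 _ _) hc.le) (h0 _ _))) fun i => by
          simp only [Q', Matrix.of_apply, Finset.sum_add_distrib, ← Finset.mul_sum]
          have h2 : Q i.succ 0 / c * ∑ j : Fin n, Q 0 j.succ ≤ Q i.succ 0 / c * c :=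
            mul_le_mul_of_nonneg_left (by linarith [hrow 0]) (div_nonneg (h0 _ _) hc.le)
          rw [div_mul_cancel₀ _ hc.ne'] at h2
          linarith [hrow i.succ]
      let d : Fin (n + 1) → ℝ := Fin.cases 0 fun i => Q i.succ 0 / c
      let M : Matrix (Fin (n + 1)) (Fin (n + 1)) ℝ :=
        Matrix.of fun i j => (1 - Q) i j + d i * (1 - Q) 0 j
      have hdet : (1 - Q).det = c * (1 - Q').det := by
        rw [← Matrix.det_eq_of_forall_row_eq_smul_add_const (A := M) d 0 rfl fun i j => rfl,
          Matrix.det_succ_column_zero, Fin.sum_univ_succ, Finset.sum_eq_zero, add_zero]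
        · have h3 : M.submatrix (Fin.succAbove 0) Fin.succ = 1 - Q' := by
            ext i j
            simp only [Matrix.submatrix_apply, Fin.zero_succAbove, M, Q', d, Matrix.of_apply,
              Matrix.sub_apply, Matrix.one_apply, Fin.cases_succ, Fin.succ_inj,
              (Fin.succ_ne_zero j).symm, if_false]
            ring
          rw [h3]
          simp [M, d, hcdef]
        · intro i _
          have h4 : M i.succ 0 = 0 := by
            simp only [M, d, Matrix.of_apply, Matrix.sub_apply, Matrix.one_apply, Fin.cases_succ,
              Fin.succ_ne_zero, if_false, if_true, ← hcdef]
            rw [div_mul_cancel₀ _ hc.ne']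
            ring
          rw [h4]
          ring
      rw [hdet]
      exact ⟨mul_nonneg hc.le hQ'.1,
        mul_le_one₀ (by linarith [h0 0 0]) hQ'.1 hQ'.2⟩

/-- `1 - Q` has a determinant between `0` and `1` if `Q` is substochastic. -/
lemma Matrix.det_one_sub_mem_Icc {ι : Type*} [Fintype ι] [DecidableEq ι] (Q : Matrix ι ι ℝ)
    (h0 : ∀ i j, 0 ≤ Q i j) (h1 : ∀ i, ∑ j, Q i j ≤ 1) : (1 - Q).det ∈ Set.Icc (0 : ℝ) 1 := by
  let e := (Fintype.equivFin ι).symm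
  have h := Matrix.det_one_sub_mem_Icc_fin _ (Q.submatrix e e) (fun i j => h0 _ _) fun i => by
    simp only [Matrix.submatrix_apply]
    rw [e.sum_comp fun j => Q (e i) j]
    exact h1 _
  rwa [← Matrix.det_submatrix_equiv_self e, Matrix.submatrix_sub, Pi.sub_apply, Pi.sub_apply,
    Matrix.submatrix_one_equiv]

namespace SSG

/-! ### Denominators of values -/

section denominators

variable {V : Type*} {G : SSG V} {σ : G.MaxStrategy} {τ : G.MinStrategy}

/-- A harmonic vector that vanishes where the game is worth nothing and at the sinks is zero. -/
lemma eq_zero_of_harmonic [Finite V] {u : V → ℝ} (hs : ∀ x, G.kind x = .sink → u x = 0)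
    (hu : ∀ x, G.kind x ≠ .sink → u x = (G.next σ τ x).avg u)
    (h0 : ∀ x, G.pairVal σ τ x = 0 → u x = 0) (x : V) : u x = 0 := by
  -- Every real multiple of `u` is harmonic and cannot be positive on a trap, so all multiples lie
  -- below a vector bounded by `1`.
  have key : ∀ (c : ℝ) x, c * u x ≤ G.pairVal σ τ x := by
    intro c
    by_contra h
    obtain ⟨S, M, hM, ⟨z, hz⟩, hS, hc, hcl⟩ := exists_closed_of_not_le_pairVal (G := G)
      (u := fun x => c * u x) (fun x hx => by
        rw [hs x hx, mul_zero]
        exact (G.val_mem x hx).1)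
      (fun x hx => by rw [PMF.avg_mul_left, ← hu x hx]) h
    have := hc z hz
    rw [h0 z (pairVal_eq_zero_of_closed hS hcl hz), mul_zero] at this
    exact hM.ne this
  by_contra hx
  have h1 := (key (2 / u x) x).trans (G.pairVal_mem σ τ x).2
  rw [div_mul_cancel₀ _ hx] at h1
  norm_num at h1

/-- In a `q`-SSG the transition probabilities have bounded common denominators. -/
lemma IsQSSG.exists_scale {q : ℕ} (hq : G.IsQSSG q) (σ : G.MaxStrategy) (τ : G.MinStrategy)
    (x : V) : ∃ (s : ℕ) (l : V → ℕ), 0 < s ∧ (G.kind x = .random → s ≤ q) ∧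
      (G.kind x ≠ .random → s = 1) ∧ ∀ y, s * (G.next σ τ x y).toReal = l y := by
  classical
  have hpure : ∀ a : V, G.kind x ≠ .random → G.next σ τ x = PMF.pure a →
      ∃ (s : ℕ) (l : V → ℕ), 0 < s ∧ (G.kind x = .random → s ≤ q) ∧
      (G.kind x ≠ .random → s = 1) ∧ ∀ y, s * (G.next σ τ x y).toReal = l y := by
    intro a hx ha
    refine ⟨1, fun y => if y = a then 1 else 0, one_pos, fun h => absurd h hx, fun _ => rfl,
      fun y => ?_⟩
    rw [ha, PMF.pure_apply]
    by_cases hy : y = a <;> simp [hy]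
  rcases hk : G.kind x with _ | _ | _ | _
  · simpa only [hk] using hpure _ (by simp [hk]) (G.next_of_max σ τ ⟨x, hk⟩)
  · simpa only [hk] using hpure _ (by simp [hk]) (G.next_of_min σ τ ⟨x, hk⟩)
  · obtain ⟨s, hs, hsq, h⟩ := hq.2 x hk
    choose l hl using h
    refine ⟨s, l, hs, fun _ => hsq, fun h => absurd rfl h, fun y => ?_⟩
    rw [G.next_of_random σ τ hk, hl, mul_div_cancel₀]
    exact_mod_cast hs.ne'
  · simpa only [hk] using hpure _ (by simp [hk]) (G.next_of_sink σ τ hk)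

/-- In a `q`-SSG with `r` random vertices, the positive values of a pair of strategies at the
vertices that are not sinks are fractions with denominator at most `q ^ r`. -/
lemma IsQSSG.isFractionLE_pairVal [Fintype V] {q : ℕ} (hq : G.IsQSSG q) (σ : G.MaxStrategy)
    (τ : G.MinStrategy) {x : V} (hx : G.kind x ≠ .sink) (hx0 : G.pairVal σ τ x ≠ 0) :
    IsFractionLE (q ^ Nat.card G.RandomVertex) (G.pairVal σ τ x) := by
  classical
  choose s l hs hsq hs1 hl using hq.exists_scale σ τ
  -- Dropping the vertices of value `0` removes all traps, so `1 - Q` is invertible although the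
  -- game need not be stopping. Clearing denominators row by row gives the integer matrix `N`.
  let U : V → Prop := fun x => G.kind x ≠ .sink ∧ G.pairVal σ τ x ≠ 0
  let Q : Matrix {x // U x} {x // U x} ℝ := Matrix.of fun x y => (G.next σ τ x.1 y.1).toReal
  let N : Matrix {x // U x} {x // U x} ℤ :=
    Matrix.of fun x y => (if x = y then (s x.1 : ℤ) else 0) - l x.1 y.1
  have hN : N.map (Int.castRingHom ℝ) = Matrix.diagonal (fun x => (s x.1 : ℝ)) * (1 - Q) := by
    ext x y
    simp only [N, Q, Matrix.map_apply, Matrix.of_apply, Matrix.diagonal_mul, Matrix.sub_apply,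
      Matrix.one_apply, mul_sub, hl]
    split_ifs <;> simp
  let ext0 : ({x // U x} → ℝ) → V → ℝ := fun z y => if h : U y then z ⟨y, h⟩ else 0
  have hext : ∀ z (y : {x // U x}), ext0 z y.1 = z y := fun z y => dif_pos y.2
  have hext' : ∀ z y, ¬ U y → ext0 z y = 0 := fun z y hy => dif_neg hy
  have hQ : ∀ z (x : {x // U x}), (Q.mulVec z) x = (G.next σ τ x.1).avg (ext0 z) := fun z x => by
    rw [PMF.avg_eq_sum_subtype _ _ (hext' z)]
    exact Finset.sum_congr rfl fun y _ => by rw [hext]; rfl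
  have hdet := Matrix.det_one_sub_mem_Icc Q (fun x y => ENNReal.toReal_nonneg) fun x => by
    have h := hQ (fun _ => 1) x
    simp only [Matrix.mulVec, dotProduct, mul_one] at h
    rw [h]
    refine (PMF.avg_mono (w := fun _ => 1) _ fun y _ => ?_).trans_eq (PMF.avg_const _ _)
    simp only [ext0]
    split_ifs <;> norm_num
  have hdet0 : (1 - Q).det ≠ 0 := by
    intro h
    obtain ⟨z, hz, hz0⟩ := Matrix.exists_mulVec_eq_zero_iff.2 h
    refine hz (funext fun x => ?_)
    rw [← hext z x]
    refine eq_zero_of_harmonic (G := G) (σ := σ) (τ := τ) (u := ext0 z)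
      (fun y hy => hext' z y fun h => h.1 hy) (fun y hy => ?_)
      (fun y hy => hext' z y fun h => h.2 hy) x.1
    by_cases hy0 : G.pairVal σ τ y = 0
    · rw [hext' z y fun h => h.2 hy0]
      refine ((PMF.avg_congr (w := fun _ => 0) _ fun w hw => hext' z w fun h => h.2 ?_).trans
        (PMF.avg_const _ _)).symm
      -- By the maximum principle for `-v`, successors of a vertex of value `0` have value `0`.
      have h1 := PMF.eq_of_le_avg (G.next σ τ y) (M := 0) (u := fun w => -1 * G.pairVal σ τ w)
        (fun w _ => by linarith [(G.pairVal_mem σ τ w).1])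
        (by rw [PMF.avg_mul_left, ← G.pairVal_eq_avg, hy0, mul_zero]) hw
      linarith
    · have h1 := congrFun hz0 ⟨y, hy, hy0⟩
      rw [Matrix.sub_mulVec, Matrix.one_mulVec, Pi.sub_apply, hQ] at h1
      exact sub_eq_zero.1 ((congrArg (· - _) (hext z ⟨y, hy, hy0⟩)).trans h1)
  have hdetN : ((N.det : ℤ) : ℝ) = (∏ x : {x // U x}, (s x.1 : ℝ)) * (1 - Q).det := by
    rw [← Matrix.det_diagonal, ← Matrix.det_mul, ← hN]
    exact (Int.castRingHom ℝ).map_det N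
  -- Only random vertices contribute scales above `1`, each at most `q`. With `det (1 - Q) ≤ 1` this
  -- bounds `det N`.
  have hprod : ∏ x : {x // U x}, s x.1 ≤ q ^ Nat.card G.RandomVertex := by
    rw [← Finset.prod_subtype (Finset.univ.filter U) (by simp) s]
    refine (Finset.prod_le_prod_of_subset_of_one_le' (Finset.filter_subset _ _)
      fun y _ _ => hs y).trans ?_
    calc ∏ y, s y ≤ ∏ y, if G.kind y = .random then q else 1 := by
          refine Finset.prod_le_prod' fun y _ => ?_
          split_ifs with hy
          · exact hsq y hy
          · exact (hs1 y hy).le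
      _ = q ^ Nat.card G.RandomVertex := by
          rw [Finset.prod_ite, Finset.prod_const, Finset.prod_const_one, mul_one,
            Nat.card_eq_fintype_card, Fintype.card_subtype]
  have hpos : (0 : ℝ) < ∏ x : {x // U x}, (s x.1 : ℝ) :=
    Finset.prod_pos fun y _ => by exact_mod_cast hs y.1
  have hNpos : 0 < N.det := by
    have : (0 : ℝ) < ((N.det : ℤ) : ℝ) := by
      rw [hdetN]
      exact mul_pos hpos (hdet.1.lt_of_ne hdet0.symm)
    exact_mod_cast this
  have hNle : N.det ≤ (q ^ Nat.card G.RandomVertex : ℕ) := by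
    have : ((N.det : ℤ) : ℝ) ≤ ((q ^ Nat.card G.RandomVertex : ℕ) : ℝ) := by
      rw [hdetN]
      refine (mul_le_of_le_one_right hpos.le hdet.2).trans ?_
      exact_mod_cast hprod
    exact_mod_cast this
  -- The values on `U` solve the integer system `N v = b`, whose right-hand side collects the scaled
  -- probabilities of moving directly to the `1`-sink.
  let c : V → ℕ := fun y => if G.kind y = .sink ∧ G.val y = 1 then 1 else 0
  let v : {x // U x} → ℝ := fun y => G.pairVal σ τ y.1
  let b : {x // U x} → ℤ := fun y => ∑ w, (l y.1 w : ℤ) * c w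
  have hext_v : ext0 v = fun y => G.pairVal σ τ y - c y := by
    funext y
    by_cases hy : G.kind y = .sink
    · rw [hext' v y fun h => h.1 hy, G.pairVal_sink σ τ hy]
      obtain ⟨⟨s₀, s₁, -, h0, -, h1, h⟩, -⟩ := hq
      rcases h y hy with rfl | rfl
      · simp [c, h0]
      · simp [c, hy, h1]
    · have hcy : c y = 0 := if_neg fun h => hy h.1
      by_cases hy0 : G.pairVal σ τ y = 0
      · rw [hext' v y fun h => h.2 hy0, hy0, hcy]
        simp
      · rw [hext v ⟨y, hy, hy0⟩, hcy]
        simp [v]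
  have hNv : (N.map (Int.castRingHom ℝ)).mulVec v = fun y => (b y : ℝ) := by
    funext y
    rw [hN, ← Matrix.mulVec_mulVec, Matrix.mulVec_diagonal, Matrix.sub_mulVec, Matrix.one_mulVec,
      Pi.sub_apply, hQ, hext_v, PMF.avg_sub, ← G.pairVal_eq_avg, PMF.avg_eq_sum]
    simp only [v, b, sub_sub_cancel, Finset.mul_sum, ← mul_assoc, hl]
    push_cast
    rfl
  have hcramer : ∀ y, (N.det : ℝ) * v y = ((N.adjugate.mulVec b y : ℤ) : ℝ) := by
    intro y
    have h1 : (N.adjugate.map (Int.castRingHom ℝ)).mulVec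
        ((N.map (Int.castRingHom ℝ)).mulVec v) = (N.det : ℝ) • v := by
      have h2 : (N.det • (1 : Matrix {x // U x} {x // U x} ℤ)).map (Int.castRingHom ℝ) =
          (N.det : ℝ) • 1 := by
        ext i j
        rw [Matrix.map_apply, Matrix.smul_apply, Matrix.smul_apply, Matrix.one_apply,
          Matrix.one_apply]
        split_ifs <;> simp
      rw [Matrix.mulVec_mulVec, ← Matrix.map_mul, Matrix.adjugate_mul, h2, Matrix.smul_mulVec,
        Matrix.one_mulVec]
    rw [hNv] at h1
    have h2 := congrFun h1 y
    rw [Pi.smul_apply, smul_eq_mul] at h2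
    rw [← h2]
    simp [Matrix.mulVec, dotProduct]
  have hdetR : (N.det : ℝ) ≠ 0 := by exact_mod_cast hNpos.ne'
  refine ⟨N.adjugate.mulVec b ⟨x, hx, hx0⟩, N.det.toNat, by omega, by omega, ?_⟩
  rw [← hcramer, show ((N.det.toNat : ℕ) : ℝ) = (N.det : ℝ) by
    exact_mod_cast Int.toNat_of_nonneg hNpos.le, mul_div_cancel_left₀ _ hdetR]

end denominators

end SSG

/-- If `a ≤ c < b`, then `c` would be strictly nearer to `a` than `b` is. -/
lemma IsNearestFraction.le {D : ℕ} {a b c : ℝ} (h : IsNearestFraction D a b)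
    (hc : IsFractionLE D c) (hac : a ≤ c) : b ≤ c := by
  by_contra! hlt
  have := h.2 c hc
  rw [abs_of_nonpos (by linarith), abs_of_nonpos (by linarith)] at this
  linarith

namespace SSG

/-! ### Runs of Opt-GSIA -/

section run

variable {V : Type*} {G : SSG V} {A : Set G.Arc}

lemma exists_isOptGSIARun [Finite V] (hA : A ⊆ G.randomArcs) (σ₀ : G.MaxStrategy) :
    ∃ σ : ℕ → G.MaxStrategy, G.IsOptGSIARun A σ ∧ σ 0 = σ₀ := by
  have h : ∀ σ : G.MaxStrategy, ∃ σ' : G.MaxStrategy,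
      (¬ G.IsOptimal σ → G.OptGSIAStep A σ σ') ∧ (G.IsOptimal σ → σ' = σ) := fun σ => by
    by_cases hσ : G.IsOptimal σ
    · exact ⟨σ, fun h => absurd hσ h, fun _ => rfl⟩
    · obtain ⟨σ', h⟩ := G.exists_optGSIAStep hA σ hσ
      exact ⟨σ', fun _ => h, fun h => absurd h hσ⟩
  choose f hf using h
  refine ⟨fun n => f^[n] σ₀, fun i => ?_, rfl⟩
  simp only [Function.iterate_succ_apply']
  exact hf (f^[i] σ₀)

namespace IsOptGSIARun

variable {σ : ℕ → G.MaxStrategy}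

/-- A run reaches an optimal strategy because its values increase strictly until then. -/
lemma exists_isOptimal [Finite V] (hA : A ⊆ G.randomArcs) (h : G.IsOptGSIARun A σ) :
    ∃ n, G.IsOptimal (σ n) := by
  by_contra! hn
  have hmono : StrictMono fun i => G.maxVal (σ i) :=
    strictMono_nat_of_lt_succ fun i => ((h i).1 (hn i)).maxVal_lt hA
  exact not_injective_infinite_finite σ
    fun i j hij => hmono.injective (congrArg G.maxVal hij)

/-- A vector that is dominated by the current strategy at the random vertices yields values of the
deterministic game that are dominated by the next strategy. -/
lemma detVal_le_maxVal [Finite V] (hA : A ⊆ G.randomArcs) (h : G.IsOptGSIARun A σ) (i : ℕ)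
    {w : G.RandomVertex → Set.Icc (0 : ℝ) 1}
    (hw : ∀ x : G.RandomVertex, (w x : ℝ) ≤ G.maxVal (σ i) x.1) (x : V) :
    G.detVal w x ≤ G.maxVal (σ (i + 1)) x := by
  by_cases hi : G.IsOptimal (σ i)
  · rw [(h i).2 hi]
    have hopt := isOptimal_iff.1 hi
    rw [hopt] at hw ⊢
    exact G.detVal_le (fun x => (G.optVal_mem x).1) (fun x hx => (G.optVal_sink hx).ge)
      (fun x y hx hy => G.optVal_le_max hx hy)
      (fun x hx => (G.exists_optVal_min hx).imp fun y hy => ⟨hy.1, hy.2.le⟩) hw x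
  · have hstep := (h i).1 hi
    -- It remains to compare two redirected games: the optimal values of `G[A, σ i]` dominate `w` at
    -- random vertices, being at least the values of `σ i`.
    refine le_trans ?_ (hstep.optVal_le hA x)
    set H := G.transform A (G.arcVal A (σ i))
    refine G.detVal_le (u := fun x => H.optVal (.inl x)) (fun x => (H.optVal_mem _).1)
      (fun x hx => (H.optVal_sink (x := .inl x) hx).ge)
      (fun x y hx hy => H.optVal_le_max (x := .inl x) (y := .inl y) hx
        ((G.transform_adj_of_ne_random hA _ (by rw [hx]; exact VertexKind.noConfusion)).2 hy))
      (fun x hx => ?_) (fun x => ?_) x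
    · obtain ⟨z, hz, hxz⟩ := H.exists_optVal_min (x := .inl x) hx
      obtain ⟨y, hy, rfl⟩ := G.exists_of_transform_adj hA _
        (by rw [hx]; exact VertexKind.noConfusion) hz
      exact ⟨y, hy, hxz.le⟩
    · refine (hw x).trans ?_
      rw [← G.maxVal_transform_arcVal hA]
      exact maxVal_le_optVal _ _ _

lemma ijma_le_maxVal [Fintype V] (hA : A ⊆ G.randomArcs) (h : G.IsOptGSIARun A σ) (i : ℕ)
    (x : G.RandomVertex) : (G.ijma i x : ℝ) ≤ G.maxVal (σ i) x.1 := by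
  induction i generalizing x with
  | zero => exact (G.maxVal_mem _ _).1
  | succ i ih =>
    rw [G.maxVal_random _ x.2, PMF.avg_eq_sum]
    exact Finset.sum_le_sum fun y _ => mul_le_mul_of_nonneg_left
      (h.detVal_le_maxVal hA i ih y) ENNReal.toReal_nonneg

/-- A run has stopped once a vector dominated by one of its strategies at the random vertices
yields the optimal values. -/
lemma isOptimal_succ [Finite V] (hA : A ⊆ G.randomArcs) (h : G.IsOptGSIARun A σ) (i : ℕ)
    {w : G.RandomVertex → Set.Icc (0 : ℝ) 1}
    (hw : ∀ x : G.RandomVertex, (w x : ℝ) ≤ G.maxVal (σ i) x.1) (hopt : G.detVal w = G.optVal) :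
    G.IsOptimal (σ (i + 1)) :=
  isOptimal_iff.2 (funext fun x => le_antisymm (G.maxVal_le_optVal _ x)
    (hopt ▸ h.detVal_le_maxVal hA i hw x))

end IsOptGSIARun

/-- Rounding to fractions with large denominators cannot exceed the value of a strategy in a
`q`-SSG. -/
lemma IsQSSG.le_maxVal_of_isNearestFraction [Fintype V] {q D : ℕ} (hq : G.IsQSSG q)
    (hD : q ^ Nat.card G.RandomVertex ≤ D) (σ : G.MaxStrategy) (x : G.RandomVertex) {a b : ℝ}
    (hab : IsNearestFraction D a b) (ha : a ≤ G.maxVal σ x.1) : b ≤ G.maxVal σ x.1 := by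
  refine hab.le ?_ ha
  obtain ⟨τ, hτ⟩ := G.exists_pairVal_eq_maxVal σ
  rw [← hτ]
  by_cases h0 : G.pairVal σ τ x.1 = 0
  · obtain ⟨qx, hqx, hle, -⟩ := hq.2 x.1 x.2
    -- The fraction `0 / 1` needs `1 ≤ D`; the existence of the random vertex `x` gives `1 ≤ q`.
    exact ⟨0, 1, one_pos, (Nat.one_le_pow _ _ (hqx.trans_le hle)).trans hD, by simp [h0]⟩
  · obtain ⟨k, m, hm, hmD, h⟩ :=
      hq.isFractionLE_pairVal σ τ (by rw [x.2]; exact VertexKind.noConfusion) h0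
    exact ⟨k, m, hm, hmD.trans hD, h⟩

end run

end SSG

end

theorem mainTheorem6 {V : Type*} [Fintype V] (G : SSG V) (A : Set G.Arc) (hA : A ⊆ G.randomArcs) :
    -- Opt-GSIA can be run from every initial strategy
    (∀ σ₀ : G.MaxStrategy, ∃ σ : ℕ → G.MaxStrategy, G.IsOptGSIARun A σ ∧ σ 0 = σ₀) ∧
    ∀ σ : ℕ → G.MaxStrategy, G.IsOptGSIARun A σ →
      -- the values of its strategies dominate the vectors of the value iteration at each step
      (∀ (i : ℕ) (x : G.RandomVertex), (G.ijma i x : ℝ) ≤ G.maxVal (σ i) x.1) ∧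
      (∀ (i : ℕ) (x : V), G.detVal (G.ijma i) x ≤ G.maxVal (σ (i + 1)) x) ∧
      -- it stops after `n` iterations
      ∃ n : ℕ, IsLeast {m : ℕ | G.IsOptimal (σ m)} n ∧
        -- `n ≤ N` if iteration `N = i + 1` of the value iteration computes the optimal values
        (∀ i : ℕ, G.detVal (G.ijma i) = G.optVal → n ≤ i + 1) ∧
        -- and also if it does so after rounding
        (∀ (q D i : ℕ) (w : G.RandomVertex → Set.Icc (0 : ℝ) 1),
          G.IsQSSG q → q ^ Nat.card G.RandomVertex ≤ D →
          (∀ x, IsNearestFraction D (G.ijma i x) (w x)) →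
          G.detVal w = G.optVal → n ≤ i + 1) := by
  refine ⟨SSG.exists_isOptGSIARun hA, fun σ h => ⟨h.ijma_le_maxVal hA, fun i =>
    h.detVal_le_maxVal hA i (h.ijma_le_maxVal hA i), ?_⟩⟩
  classical
  have hex := h.exists_isOptimal hA
  refine ⟨Nat.find hex, ⟨Nat.find_spec hex, fun m hm => Nat.find_min' hex hm⟩, fun i hi =>
    Nat.find_min' hex (h.isOptimal_succ hA i (h.ijma_le_maxVal hA i) hi),
    fun q D i w hq hD hw hi => Nat.find_min' hex (h.isOptimal_succ hA i (fun x => ?_) hi)⟩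
  exact hq.le_maxVal_of_isNearestFraction hD (σ i) x (hw x) (h.ijma_le_maxVal hA i x)
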